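/- Let $q$ be a prime power, $n\ge 2$, $1\le i\le n-1$, $K=\mathbb{F}_{q^n}$ and $F=K(x)$ the rational function field. Let $s_{n,i}(t)\in K[t]$ be the $i$-th elementary symmetric polynomial in $n$ variables evaluated at $(t,t^q,\dots,t^{q^{n-1}})$. Let $E=E_{i,Kum}=F(y)$, where $y$ satisfies $$y^{\frac{q^n-1}{q-1}}=s_{n,i}(x).$$ Write $v_P$ for the normalized discrete valuation of a place $P$, $e(P'|P)$ and $d(P'|P)$ for the ramification index and the different exponent of a place $P'$ of $E$ above a place $P$ of $F$, $P_0$ for the zero of $x$ and $P_\infty$ for the pole of $x$ in $F$. Then the following hold. (i) $E/F$ is a cyclic Galois extension of degree $[E:F]=\frac{q^n-1}{q-1}$. The field $K$ contains a primitive $\frac{q^n-1}{q-1}$-th root of unity, and for every such root $\xi$, $\mathrm{Gal}(E/F)=\{\sigma_k: y\mapsto y\xi^k\}_{1\le k\le \frac{q^n-1}{q-1}}$, where the $\sigma_k$ are pairwise distinct. (ii) The places of $F$ that are ramified in $E$ are exactly $P_\infty$ and the zeros of $s_{n,i}(x)$, that is, the places $P$ of $F$, of any degree, with $v_P(s_{n,i}(x))>0$.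 If $P$ is $P_\infty$ or a zero of $s_{n,i}(x)$, then for every place $P'$ of $E$ above $P$, $$e(P'|P)=\frac{[E:F]}{\gcd\bigl([E:F],\,v_P(s_{n,i}(x))\bigr)}.$$ The extension is tame: for every place $P$ of $F$ and every place $P'$ of $E$ above $P$, the characteristic of $K$ does not divide $e(P'|P)$, and $d(P'|P)=e(P'|P)-1$. Moreover, $$v_{P_0}(s_{n,i}(x))=\frac{q^i-1}{q-1},\qquad v_{P_\infty}(s_{n,i}(x))=-q^{n-i}\,\frac{q^i-1}{q-1}.$$ (iii) All other rational places of $F$ (places of degree one that are neither $P_\infty$ nor a zero of $s_{n,i}(x)$) split completely in $E$: exactly $[E:F]$ places of $E$ lie above each of them. -/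

import Mathlib

open Polynomial IntermediateField

noncomputable section

/-- The `i`-th `(n, q)`-elementary symmetric polynomial `s_{n,i}(t)`: the `i`-th elementary
symmetric polynomial in `n` variables evaluated at `(t, t^q, …, t^(q^(n-1)))`. -/
def nqSymm (K : Type*) [CommRing K] (q n i : ℕ) : K[X] :=
  MvPolynomial.aeval (fun j : Fin n => (X : K[X]) ^ (q ^ (j : ℕ))) (MvPolynomial.esymm (Fin n) K i)

/-- A place of a field `L` over the constant field `K`, given by its valuation ring `𝒪_P`:
a valuation ring of `L` with `K ⊆ 𝒪_P ⊊ L`. The place itself is the maximal ideal of `𝒪_P`. -/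
@[ext]
structure FFPlace (K L : Type*) [Field K] [Field L] [Algebra K L] where
  /-- The valuation ring `𝒪_P`. -/
  ring : ValuationSubring L
  const_mem : ∀ c : K, algebraMap K L c ∈ ring
  ne_top : ring ≠ ⊤

namespace FFPlace

variable {K L : Type*} [Field K] [Field L] [Algebra K L]

/-- `v_P(f) = k`: there are a local parameter `t` (a generator of the maximal ideal of `𝒪_P`)
and a unit `u` of `𝒪_P` with `f = t ^ k * u`. -/
def HasOrd (P : FFPlace K L) (f : L) (k : ℤ) : Prop :=
  ∃ t : P.ring, IsLocalRing.maximalIdeal P.ring = Ideal.span {t} ∧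
    ∃ u : P.ringˣ, f = (t : L) ^ k * ((u : P.ring) : L)

open Classical in
/-- The normalized discrete valuation `v_P(f)` of `f ≠ 0`
(with the conventional value `0` at `f = 0`, where the valuation is infinite). -/
def ord (P : FFPlace K L) (f : L) : ℤ :=
  if h : ∃ k : ℤ, P.HasOrd f k then h.choose else 0

/-- The inclusion of the constants `K → 𝒪_P`. -/
def constHom (P : FFPlace K L) : K →+* P.ring :=
  (algebraMap K L).codRestrict P.ring P.const_mem

/-- `P` is rational, i.e. of degree one: the residue field `𝒪_P / P` equals `K`. -/
def IsRational (P : FFPlace K L) : Prop :=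
  Function.Surjective ((IsLocalRing.residue P.ring).comp P.constHom)

theorem localParam_ne_zero (P : FFPlace K L) {t : P.ring}
    (ht : IsLocalRing.maximalIdeal P.ring = Ideal.span {t}) : (t : L) ≠ 0 := by
  intro h0
  apply P.ne_top
  have ht0 : t = 0 := Subtype.ext h0
  rw [ht0, Ideal.span_singleton_zero] at ht
  have hfield : IsField P.ring := IsLocalRing.isField_iff_maximalIdeal_eq.2 ht
  refine eq_top_iff.2 fun x _ => ?_
  rcases P.ring.mem_or_inv_mem x with hx | hx
  · exact hx
  · by_cases hx0 : x = 0
    · rw [hx0]; exact zero_mem _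
    · obtain ⟨b, hb⟩ := hfield.mul_inv_cancel (a := (⟨x⁻¹, hx⟩ : P.ring))
        (fun h => hx0 (inv_eq_zero.1 (congrArg Subtype.val h)))
      have hb' : x⁻¹ * (b : L) = 1 := congrArg Subtype.val hb
      have : x = (b : L) := by field_simp at hb'; exact hb'.symm
      rw [this]; exact b.2

/-- The valuation `v_P(f)` is well defined. -/
theorem HasOrd.unique {P : FFPlace K L} {f : L} {k l : ℤ} (hk : P.HasOrd f k)
    (hl : P.HasOrd f l) : k = l := by
  obtain ⟨t, ht, u, hu⟩ := hk
  obtain ⟨t', ht', u', hu'⟩ := hl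
  have hass : Associated t t' := by
    rw [← Ideal.span_singleton_eq_span_singleton, ← ht, ht']
  obtain ⟨w, hw⟩ := hass
  have ht0 := P.localParam_ne_zero ht
  have key : ∀ (v : P.ringˣ) (m : ℤ), (((v ^ m : P.ringˣ) : P.ring) : L) = ((v : P.ring) : L) ^ m :=
    fun v m => by
      have h2 : ((Units.map (P.ring.subtype : P.ring →* L) (v ^ m) : Lˣ) : L)
          = ((Units.map (P.ring.subtype : P.ring →* L) v : Lˣ) : L) ^ m := by
        rw [map_zpow, Units.val_zpow_eq_zpow_val]
      exact h2
  have hu0 : ((u : P.ring) : L) ≠ 0 := fun h => u.ne_zero (Subtype.ext h)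
  have hw0 : ((w : P.ring) : L) ≠ 0 := fun h => w.ne_zero (Subtype.ext h)
  have hw' : (t' : L) = (t : L) * ((w : P.ring) : L) := by rw [← hw]; rfl
  -- a power of the local parameter with positive exponent is not a unit
  have main : ∀ (m : ℕ) (v : P.ringˣ), (t : L) ^ m = ((v : P.ring) : L) → m = 0 := by
    intro m v h
    by_contra hm
    have h1 : t ^ m = (v : P.ring) := Subtype.ext (by simpa using h)
    have h2 : IsUnit t := (isUnit_pow_iff hm).1 (h1 ▸ v.isUnit)
    have h3 : t ∈ IsLocalRing.maximalIdeal P.ring := by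
      rw [ht]; exact Ideal.mem_span_singleton_self t
    exact (IsLocalRing.mem_maximalIdeal t).1 h3 h2
  have heq : (t : L) ^ (k - l) = (((w ^ l * u' * u⁻¹ : P.ringˣ) : P.ring) : L) := by
    have hinv : (((u⁻¹ : P.ringˣ) : P.ring) : L) = ((u : P.ring) : L)⁻¹ := by
      simpa using key u (-1)
    have h1 : (t : L) ^ k * ((u : P.ring) : L)
        = (t : L) ^ l * ((w : P.ring) : L) ^ l * ((u' : P.ring) : L) := by
      rw [← hu, hu', hw', mul_zpow]
    push_cast
    rw [key, hinv, zpow_sub₀ ht0, div_eq_iff (zpow_ne_zero _ ht0)]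
    field_simp
    linear_combination h1
  rcases le_total l k with h | h
  · have := main (k - l).toNat (w ^ l * u' * u⁻¹) (by
      rw [← heq, ← zpow_natCast, Int.toNat_of_nonneg (by omega)])
    omega
  · have := main (l - k).toNat (w ^ l * u' * u⁻¹)⁻¹ (by
      have hinv := key (w ^ l * u' * u⁻¹) (-1)
      rw [zpow_neg_one, zpow_neg_one, ← heq, ← zpow_neg] at hinv
      rw [hinv, ← zpow_natCast, Int.toNat_of_nonneg (by omega)]
      congr 1; ring)
    omega

theorem HasOrd.ord_eq {P : FFPlace K L} {f : L} {k : ℤ} (h : P.HasOrd f k) : P.ord f = k := by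
  have h' : ∃ k : ℤ, P.HasOrd f k := ⟨k, h⟩
  rw [ord, dif_pos h']
  exact h'.choose_spec.unique h

section Extension

variable {F E : Type*} [Field F] [Algebra K F] [Field E] [Algebra K E] [Algebra F E]

/-- `P' ∣ P`: the place `P'` of `E` lies above the place `P` of `F`, i.e. `𝒪_P = 𝒪_{P'} ∩ F`. -/
def LiesOver (P' : FFPlace K E) (P : FFPlace K F) : Prop :=
  P'.ring.comap (algebraMap F E) = P.ring

open Classical in
/-- The ramification index `e(P' ∣ P)`: the positive integer `e` such that
`v_{P'}(z) = e · v_P(z)` for all nonzero `z ∈ F`. -/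
def ramIdx (P' : FFPlace K E) (P : FFPlace K F) : ℕ :=
  if h : ∃ e : ℕ, 0 < e ∧ ∀ z : F, z ≠ 0 → P'.ord (algebraMap F E z) = e * P.ord z
  then h.choose else 0

/-- The ramification index is well defined. -/
theorem ramIdx_eq {P' : FFPlace K E} {P : FFPlace K F} {e : ℕ} (he : 0 < e)
    (h : ∀ z : F, z ≠ 0 → P'.ord (algebraMap F E z) = e * P.ord z)
    {z : F} (hz : z ≠ 0) (hPz : P.ord z ≠ 0) : P'.ramIdx P = e := by
  have h' : ∃ e : ℕ, 0 < e ∧ ∀ z : F, z ≠ 0 → P'.ord (algebraMap F E z) = e * P.ord z :=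
    ⟨e, he, h⟩
  rw [ramIdx, dif_pos h']
  have h1 := h'.choose_spec.2 z hz
  rw [h z hz] at h1
  exact_mod_cast (mul_right_cancel₀ hPz h1).symm

/-- `P` is ramified in `E` if `e(P' ∣ P) > 1` for some place `P'` of `E` above `P`. -/
def IsRamifiedIn (P : FFPlace K F) (E : Type*) [Field E] [Algebra K E] [Algebra F E] : Prop :=
  ∃ P' : FFPlace K E, P'.LiesOver P ∧ 1 < P'.ramIdx P

/-- `P` splits completely in `E` if exactly `[E : F]` places of `E` lie above `P`
(for a finite extension `E / F`). -/
def SplitsCompletelyIn (P : FFPlace K F) (E : Type*) [Field E] [Algebra K E] [Algebra F E] : Prop :=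
  {P' : FFPlace K E | P'.LiesOver P}.ncard = Module.finrank F E

/-- `w ∈ E` belongs to the integral closure `𝒪'_P` of `𝒪_P` in `E`. -/
def IsIntegralAt (P : FFPlace K F) (w : E) : Prop :=
  ((algebraMap F E).comp P.ring.subtype).IsIntegralElem w

/-- The complementary module `C_P = {z ∈ E | Tr_{E/F}(z · 𝒪'_P) ⊆ 𝒪_P}` over `𝒪_P`. -/
def complementaryModule (P : FFPlace K F) (E : Type*) [Field E] [Algebra F E] : Set E :=
  {z : E | ∀ w : E, P.IsIntegralAt w → Algebra.trace F E (z * w) ∈ P.ring}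

/-- The different exponent `d(P' ∣ P)` equals `d`: one has `C_P = t · 𝒪'_P` for some nonzero
`t ∈ E`, and `d = -v_{P'}(t)`. -/
def HasDifferentExponent (P' : FFPlace K E) (P : FFPlace K F) (d : ℤ) : Prop :=
  ∃ t : E, t ≠ 0 ∧ P.complementaryModule E = {z : E | ∃ w : E, P.IsIntegralAt w ∧ z = t * w} ∧
    d = -P'.ord t

end Extension

section Rational

variable (K)

open Classical in
/-- The place `P_∞` of `K(x)`: the pole of `x`. -/
def infty : FFPlace K (RatFunc K) where
  ring := (RatFunc.inftyValuation K).valuationSubring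
  const_mem c := by
    rw [Valuation.mem_valuationSubring_iff, RatFunc.algebraMap_eq_C]
    by_cases hc : c = 0
    · simp [hc]
    · rw [RatFunc.inftyValuation.C K hc]
  ne_top h := by
    have hX : (RatFunc.X : RatFunc K) ∈ (RatFunc.inftyValuation K).valuationSubring := by
      rw [h]; trivial
    rw [Valuation.mem_valuationSubring_iff, RatFunc.inftyValuation.X, ← WithZero.exp_zero,
      WithZero.exp_le_exp] at hX
    omega

variable {K}

/-- The prime ideal `(X - α)` of `K[X]`. -/
def idealXSub (α : K) : IsDedekindDomain.HeightOneSpectrum K[X] where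
  asIdeal := Ideal.span {X - C α}
  isPrime := (Ideal.span_singleton_prime (X_sub_C_ne_zero α)).2 (prime_X_sub_C α)
  ne_bot := by
    rw [Ne, Ideal.span_singleton_eq_bot]
    exact X_sub_C_ne_zero α

/-- The place `P_α` of `K(x)`: the zero of `x - α`. -/
def zeroOf (α : K) : FFPlace K (RatFunc K) where
  ring := ((idealXSub α).valuation (RatFunc K)).valuationSubring
  const_mem c := by
    rw [Valuation.mem_valuationSubring_iff,
      IsScalarTower.algebraMap_apply K K[X] (RatFunc K)]
    exact (idealXSub α).valuation_le_one _
  ne_top h := by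
    have hlt : (idealXSub α).valuation (RatFunc K)
        (algebraMap K[X] (RatFunc K) (X - C α)) < 1 := by
      rw [IsDedekindDomain.HeightOneSpectrum.valuation_lt_one_iff_mem]
      exact Ideal.mem_span_singleton_self _
    have hmem : (algebraMap K[X] (RatFunc K) (X - C α))⁻¹ ∈
        ((idealXSub α).valuation (RatFunc K)).valuationSubring := by
      rw [h]; trivial
    rw [Valuation.mem_valuationSubring_iff, map_inv₀] at hmem
    have h0 : (idealXSub α).valuation (RatFunc K)
        (algebraMap K[X] (RatFunc K) (X - C α)) ≠ 0 := by
      rw [Valuation.ne_zero_iff]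
      exact (map_ne_zero_iff _ (IsFractionRing.injective K[X] (RatFunc K))).2 (X_sub_C_ne_zero α)
    exact absurd hmem (not_le.2 ((one_lt_inv₀ (zero_lt_iff.2 h0)).2 hlt))

end Rational

end FFPlace

end

/-! Put m = (q^n - 1)/(q - 1) = 1 + q + … + q^(n-1) and s = s_{n,i}(x). The global part is Kummer
theory once X^m - s is irreducible, and this is Eisenstein's criterion at a simple zero of s in K.

Such a zero exists by counting (`exists_simple_root_nqSymm`). On K the polynomial s_{n,i} takes
values in 𝔽_q, and inversion exchanges its zeros with those of s_{n,n-i}. The latter has degree D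
with (q - 1)D = q^n - q^i, so the nonzero values leave at least q^i zeros. The derivative of s_{n,i}
is the symmetric function of degree i - 1 in the remaining variables x^q, x^(q^2), …. Where it
vanishes on K, x satisfies an equation of degree i - 1 over 𝔽_q, so x^(q^d) = x for some 1 ≤ d ≤ i -
1. Fewer than q^i elements do this.

The local part rests on σ : y ↦ ξy. As m is invertible in K, inclusions between σ-stable K-subspaces
of E need only be tested on eigenvectors a y^j (`le_of_eigenvectors`). Their m-th powers lie in F,
so integrality is read off from orders in F. With g = gcd(m, v_P(s)), Bézout gives an eigenvector w
whose m-th power has order g at P. It divides every element lying in all places above P, hence has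
order 1 at each P' (`ord_localParam`). Therefore e = m/g, and the complementary module is w^(1-e)
𝒪'_P. Since deg s < m, every order of s is less than m in absolute value, so P ramifies exactly when
v_P(s) ≠ 0.

At a remaining rational place x = α, the value s(α) lies in 𝔽_q^×. It is an m-th power β^m because
K^× is cyclic of order (q - 1)m. Then y ≡ βξ^k modulo P', and k mod m labels the places above
(`ncard_liesOver`). -/

/-- The elementary symmetric function of degree `i` of `x, x ^ q, …, x ^ (q ^ (n - 1))`. -/
noncomputable def frobSymm {R : Type*} [CommRing R] (q n i : ℕ) (x : R) : R :=
  (∏ j ∈ Finset.range n, (1 + C (x ^ q ^ j) * (X : R[X]))).coeff i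

/-! ### Identities for symmetric functions of Frobenius powers -/

namespace frobSymm

section CommRing

variable {R : Type*} [CommRing R] (q : ℕ)

theorem zero_left (i : ℕ) (x : R) : frobSymm q 0 (i + 1) x = 0 := by
  simp [frobSymm, coeff_one]

@[simp] theorem zero_right (n : ℕ) (x : R) : frobSymm q n 0 x = 1 := by
  simp [frobSymm, coeff_zero_eq_eval_zero, eval_prod]

theorem succ_succ (n i : ℕ) (x : R) : frobSymm q (n + 1) (i + 1) x =
    frobSymm q n (i + 1) x + x ^ q ^ n * frobSymm q n i x := by
  rw [frobSymm, Finset.prod_range_succ, mul_add, mul_one, coeff_add, ← mul_assoc, coeff_mul_X,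
    coeff_mul_C, mul_comm]
  rfl

theorem prod_succ' (n : ℕ) (x : R) :
    ∏ j ∈ Finset.range (n + 1), (1 + C (x ^ q ^ j) * (X : R[X])) =
      (1 + C x * X) * ∏ j ∈ Finset.range n, (1 + C ((x ^ q) ^ q ^ j) * (X : R[X])) := by
  rw [Finset.prod_range_succ', mul_comm]
  simp [← pow_mul, pow_succ']

theorem succ_succ' (n i : ℕ) (x : R) : frobSymm q (n + 1) (i + 1) x =
    frobSymm q n (i + 1) (x ^ q) + x * frobSymm q n i (x ^ q) := by
  rw [frobSymm, prod_succ', add_mul, one_mul, coeff_add, mul_assoc, coeff_C_mul, coeff_X_mul]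
  rfl

theorem eq_zero_of_lt {n i : ℕ} (h : n < i) (x : R) : frobSymm q n i x = 0 := by
  induction n generalizing i with
  | zero => obtain ⟨i, rfl⟩ := Nat.exists_eq_succ_of_ne_zero h.ne'; exact zero_left q i x
  | succ n ih =>
    obtain ⟨i, rfl⟩ := Nat.exists_eq_succ_of_ne_zero (Nat.ne_zero_of_lt h)
    rw [Nat.succ_eq_add_one, succ_succ, ih (by omega), ih (by omega), mul_zero, add_zero]

theorem map {S : Type*} [CommRing S] (f : R →+* S) (n i : ℕ) (x : R) :
    f (frobSymm q n i x) = frobSymm q n i (f x) := by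
  simp only [frobSymm]
  rw [← coeff_map]
  simp [Polynomial.map_prod]

theorem pow_eq (φ : R →+* R) (hφ : ∀ x, φ x = x ^ q) (n i : ℕ) (x : R) :
    frobSymm q n i x ^ q = frobSymm q n i (x ^ q) := by
  rw [← hφ, map, hφ]

/-- The expression of the symmetric functions of `x ^ q, …, x ^ (q ^ n)` by those of
`x, x ^ q, …, x ^ (q ^ n)`. -/
theorem eq_sum (n k : ℕ) (x : R) : frobSymm q n k (x ^ q) =
    ∑ j ∈ Finset.range (k + 1), (-x) ^ j * frobSymm q (n + 1) (k - j) x := by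
  induction k with
  | zero => simp
  | succ k ih =>
    rw [Finset.sum_range_succ']
    -- Splitting off the variable x gives a recursion, which is solved for the symmetric function of
    -- the other variables.
    have h := succ_succ' q n k x
    rw [eq_sub_of_add_eq h.symm, ih, Finset.mul_sum, sub_eq_neg_add, ← Finset.sum_neg_distrib]
    simp only [pow_zero, one_mul, Nat.sub_zero, add_left_inj]
    exact Finset.sum_congr rfl fun j _ => by rw [Nat.add_sub_add_right]; ring

end CommRing

theorem esymm_eq {R : Type*} [CommRing R] (q n i : ℕ) (x : R) :
    MvPolynomial.aeval (fun j : Fin n => x ^ q ^ (j : ℕ)) (MvPolynomial.esymm (Fin n) R i) =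
      frobSymm q n i x := by
  classical
  rw [MvPolynomial.esymm, map_sum, frobSymm,
    ← Fin.prod_univ_eq_prod_range (fun j => 1 + C (x ^ q ^ j) * (X : R[X])), Finset.prod_one_add,
    finsetSum_coeff, Finset.powersetCard_eq_filter, Finset.sum_filter]
  refine Finset.sum_congr rfl fun t _ => ?_
  rw [Finset.prod_mul_distrib, Finset.prod_const, ← map_prod, coeff_C_mul_X_pow, map_prod]
  simp [eq_comm]

end frobSymm

theorem nqSymm_eq_frobSymm (K : Type*) [CommRing K] (q n i : ℕ) :
    nqSymm K q n i = frobSymm q n i (X : K[X]) := by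
  classical
  rw [nqSymm, ← frobSymm.esymm_eq]
  simp [MvPolynomial.esymm, map_sum, map_prod]

theorem eval_nqSymm {K : Type*} [CommRing K] (q n i : ℕ) (α : K) :
    (nqSymm K q n i).eval α = frobSymm q n i α := by
  rw [nqSymm_eq_frobSymm, ← coe_evalRingHom, frobSymm.map, coe_evalRingHom, eval_X]

namespace frobSymm

/-- A product of inverses times the product of all variables is the product over the complementary
index set. This exchanges the degrees i and n - i. -/
theorem reverse {K : Type*} [Field K] (q : ℕ) {x : K} (hx : x ≠ 0) {n i k : ℕ} (h : i + k = n) :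
    frobSymm q n k x⁻¹ * ∏ j ∈ Finset.range n, x ^ q ^ j = frobSymm q n i x := by
  induction n generalizing i k with
  | zero =>
    obtain ⟨rfl, rfl⟩ : i = 0 ∧ k = 0 := by omega
    simp
  | succ n ih =>
    have hx' : x ^ q ^ n ≠ 0 := pow_ne_zero _ hx
    rw [Finset.prod_range_succ]
    rcases i with _ | i <;> rcases k with _ | k
    · omega
    · have h1 := ih (show 0 + k = n by omega)
      rw [zero_right] at h1
      rw [succ_succ, eq_zero_of_lt q (show n < k + 1 by omega), zero_right, ← h1, inv_pow]
      field_simp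
      ring
    · have h1 := ih (show i + 0 = n by omega)
      rw [zero_right, one_mul] at h1
      rw [succ_succ, eq_zero_of_lt q (show n < i + 1 by omega), zero_right, ← h1]
      ring
    · have h1 := ih (show i + (k + 1) = n by omega)
      have h2 := ih (show i + 1 + k = n by omega)
      rw [succ_succ, succ_succ, ← h1, ← h2, inv_pow]
      field_simp
      ring

/-- The values on `𝔽_{q^n}` lie in `𝔽_q`. -/
theorem pow_eq_self {K : Type*} [Field K] (q : ℕ) (φ : K →+* K) (hφ : ∀ x, φ x = x ^ q) {n : ℕ}
    {x : K} (hx : x ^ q ^ n = x) (i : ℕ) : frobSymm q n i x ^ q = frobSymm q n i x := by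
  rw [pow_eq q φ hφ]
  -- As x^(q^n) = x, splitting off either end of the product over n + 1 factors leaves the factor 1
  -- + xX. Cancelling it shows that the Frobenius permutes the variables cyclically.
  have h1 := prod_succ' q n x
  rw [Finset.prod_range_succ, hx, mul_comm] at h1
  have h0 : (1 + C x * X : K[X]) ≠ 0 := fun h => by simpa using congrArg (eval 0) h
  exact congrArg (fun f => f.coeff i) (mul_left_cancel₀ h0 h1).symm

end frobSymm

theorem exists_ringHom_eq_pow {R : Type*} [CommRing R] {p : ℕ} [Fact p.Prime] [CharP R p] (k : ℕ) :
    ∃ φ : R →+* R, ∀ x, φ x = x ^ p ^ k :=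
  ⟨iterateFrobenius R p k, fun x => iterateFrobenius_def p k x⟩

theorem charP_of_card {K : Type*} [Field K] [Finite K] {p k n : ℕ} (hp : p.Prime)
    (hK : Nat.card K = (p ^ k) ^ n) : CharP K p := by
  have := Fintype.ofFinite K
  obtain ⟨r, hr⟩ := CharP.exists K
  obtain ⟨f, hr', hf⟩ := FiniteField.card K r
  rw [Nat.card_eq_fintype_card, hf, ← pow_mul] at hK
  have h1 : r ∣ p ^ (k * n) := hK ▸ dvd_pow_self r f.ne_zero
  have h2 := (Nat.prime_dvd_prime_iff_eq hr' hp).1 (hr'.dvd_of_dvd_pow h1)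
  exact h2 ▸ hr

theorem geom_sum_lt_pow {q : ℕ} (hq : 2 ≤ q) (n : ℕ) : ∑ j ∈ Finset.range n, q ^ j < q ^ n := by
  rw [Nat.geomSum_eq hq]
  exact (Nat.div_le_self _ _).trans_lt (by have := Nat.pow_pos (n := n) (by omega : 0 < q); omega)

namespace frobSymm

/-- The leading term is the product of the i largest powers x^(q^(n-1)), …, x^(q^(n-i)); in the
recursion, the summand containing the last variable dominates. -/
theorem monic_natDegree {K : Type*} [Field K] {q : ℕ} (hq : 2 ≤ q) {n i : ℕ} (h : i ≤ n) :
    (frobSymm q n i (X : K[X])).Monic ∧ (frobSymm q n i (X : K[X])).natDegree =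
      q ^ (n - i) * ∑ j ∈ Finset.range i, q ^ j := by
  induction n generalizing i with
  | zero => obtain rfl : i = 0 := by omega
            simp
  | succ n ih =>
    rcases i with _ | i
    · simp
    rw [succ_succ]
    obtain ⟨hm, hd⟩ := ih (show i ≤ n by omega)
    have hm' : ((X : K[X]) ^ q ^ n * frobSymm q n i X).Monic := (monic_X_pow _).mul hm
    have hd' : ((X : K[X]) ^ q ^ n * frobSymm q n i X).natDegree =
        q ^ (n + 1 - (i + 1)) * ∑ j ∈ Finset.range (i + 1), q ^ j := by
      rw [(monic_X_pow _).natDegree_mul hm, natDegree_X_pow, hd, Finset.sum_range_succ, mul_add,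
        Nat.add_sub_add_right, ← pow_add, Nat.sub_add_cancel (by omega), add_comm]
    have hlt : (frobSymm q n (i + 1) (X : K[X])).degree <
        ((X : K[X]) ^ q ^ n * frobSymm q n i X).degree := by
      rcases Nat.lt_or_ge n (i + 1) with h' | h'
      · rw [eq_zero_of_lt q h', degree_zero, bot_lt_iff_ne_bot, Ne, degree_eq_bot]
        exact hm'.ne_zero
      · obtain ⟨hm2, hd2⟩ := ih h'
        rw [degree_eq_natDegree hm2.ne_zero, degree_eq_natDegree hm'.ne_zero, hd2, hd',
          Nat.cast_lt]
        refine Nat.mul_lt_mul_of_pos_right (Nat.pow_lt_pow_right (by omega) (by omega)) ?_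
        exact Finset.sum_pos (fun _ _ => Nat.pow_pos (by omega)) ⟨0, by simp⟩
    refine ⟨hm'.add_of_right hlt, ?_⟩
    rw [natDegree_add_eq_right_of_degree_lt hlt, hd']

/-- Dually, the lowest term is the product of the i smallest powers x, …, x^(q^(i-1)). -/
theorem exists_eq_X_pow_mul {K : Type*} [Field K] {q : ℕ} (hq : 2 ≤ q) {n i : ℕ} (h : i ≤ n) :
    ∃ u : K[X], u.eval 0 = 1 ∧ frobSymm q n i (X : K[X]) =
      X ^ (∑ j ∈ Finset.range i, q ^ j) * u := by
  induction n generalizing i with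
  | zero => obtain rfl : i = 0 := by omega
            exact ⟨1, by simp⟩
  | succ n ih =>
    rcases i with _ | i
    · exact ⟨1, by simp⟩
    obtain ⟨u, hu, hu'⟩ := ih (show i ≤ n by omega)
    rw [succ_succ, hu']
    rcases Nat.lt_or_ge n (i + 1) with h' | h'
    · obtain rfl : i = n := by omega
      refine ⟨u, hu, ?_⟩
      rw [eq_zero_of_lt q h', Finset.sum_range_succ, pow_add]
      ring
    · obtain ⟨w, hw, hw'⟩ := ih h'
      have hlt : q ^ i < q ^ n := Nat.pow_lt_pow_right (by omega) (by omega)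
      refine ⟨w + X ^ (q ^ n - q ^ i) * u, ?_, ?_⟩
      · have : q ^ n - q ^ i ≠ 0 := by omega
        simp [hw, this]
      · have e : q ^ n = q ^ i + (q ^ n - q ^ i) := by omega
        rw [hw', Finset.sum_range_succ, mul_add]
        congr 1
        conv_lhs => rw [e]
        ring

/-- Only the first variable x has nonzero derivative; the others are q-th powers, and q = 0 in K. -/
theorem derivative_eq {K : Type*} [Field K] (q : ℕ) (φ : K[X] →+* K[X]) (hφ : ∀ x, φ x = x ^ q)
    (hq0 : (q : K) = 0) (n i : ℕ) :
    derivative (frobSymm q (n + 1) (i + 1) (X : K[X])) = frobSymm q n i (X ^ q) := by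
  have h (k : ℕ) : derivative (frobSymm q n k ((X : K[X]) ^ q)) = 0 := by
    rw [← pow_eq q φ hφ, derivative_pow, hq0]
    simp
  rw [succ_succ', derivative_add, derivative_mul, h, h]
  simp

/-- By `eq_sum` the hypothesis is an equation for x of degree k whose coefficients are values of
symmetric functions on x, hence fixed by φ. Its roots include all Frobenius conjugates of x, so
there are at most k of them. -/
theorem exists_pow_eq_self {K : Type*} [Field K] (q : ℕ) (φ : K →+* K) (hφ : ∀ x, φ x = x ^ q)
    {n k : ℕ} {x : K} (hx : x ^ q ^ (n + 1) = x) (h0 : frobSymm q n k (x ^ q) = 0) :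
    ∃ d ∈ Finset.Icc 1 k, x ^ q ^ d = x := by
  set f : K[X] := ∑ j ∈ Finset.range (k + 1), (-X) ^ j * C (frobSymm q (n + 1) (k - j) x) with hf
  have hmap : f.map φ = f := by
    rw [hf, Polynomial.map_sum]
    refine Finset.sum_congr rfl fun j _ => ?_
    rw [Polynomial.map_mul, Polynomial.map_pow, Polynomial.map_neg, map_X, map_C, hφ,
      pow_eq_self q φ hφ hx]
  have hroot (j : ℕ) : f.eval (x ^ q ^ j) = 0 := by
    induction j with
    | zero =>
      rw [pow_zero, pow_one, ← h0, eq_sum, hf, eval_finsetSum]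
      simp
    | succ j ih =>
      rw [pow_succ, pow_mul, ← hφ, ← hmap, eval_map_apply, ih, map_zero]
  have hsgn (j : ℕ) : ((-X : K[X])) ^ j = C ((-1) ^ j) * X ^ j := by
    rw [neg_pow]; simp
  have hne : f ≠ 0 := by
    intro h
    have h1 : f.coeff k = (-1) ^ k := by
      rw [hf, finsetSum_coeff, Finset.sum_eq_single k]
      · rw [Nat.sub_self, zero_right, C_1, mul_one, hsgn, coeff_C_mul_X_pow, if_pos rfl]
      · intro j _ hj
        rw [hsgn, coeff_mul_C, coeff_C_mul_X_pow, if_neg (Ne.symm hj), zero_mul]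
      · simp
    rw [h, coeff_zero] at h1
    exact pow_ne_zero k (neg_ne_zero.2 one_ne_zero) h1.symm
  have hdeg : f.natDegree ≤ k := by
    refine natDegree_sum_le_of_forall_le _ _ fun j hj => ?_
    rw [hsgn, mul_right_comm, ← C_mul]
    exact (natDegree_C_mul_X_pow_le _ _).trans (Nat.lt_succ_iff.1 (Finset.mem_range.1 hj))
  have hinj : Function.Injective φ := φ.injective
  -- The k + 1 conjugates with exponents 0, …, k lie among at most k roots, so two coincide.
  have hcol : ∃ a b, a < b ∧ b ≤ k ∧ x ^ q ^ a = x ^ q ^ b := by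
    classical
    have hcard : f.roots.toFinset.card < (Finset.range (k + 1)).card := by
      rw [Finset.card_range]
      exact Nat.lt_succ_iff.2 ((Multiset.toFinset_card_le _).trans ((card_roots' f).trans hdeg))
    obtain ⟨a, ha, b, hb, hab, h⟩ := Finset.exists_ne_map_eq_of_card_lt_of_maps_to hcard
      (f := fun j => x ^ q ^ j) (fun j _ => by
        simpa [hne] using hroot j)
    rw [Finset.mem_range] at ha hb
    rcases Nat.lt_or_gt_of_ne hab with h' | h'
    · exact ⟨a, b, h', by omega, h⟩
    · exact ⟨b, a, h', by omega, h.symm⟩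
  obtain ⟨a, b, hab, hb, h⟩ := hcol
  -- Injectivity of the Frobenius strips the common power q^a.
  have key (a c : ℕ) (h : x ^ q ^ a = x ^ q ^ (a + c)) : x ^ q ^ c = x := by
    induction a with
    | zero => simpa using h.symm
    | succ a ih =>
      apply ih
      apply hinj
      rw [hφ, hφ, ← pow_mul, ← pow_mul, ← pow_succ, ← pow_succ, h]
      congr 2; omega
  exact ⟨b - a, by rw [Finset.mem_Icc]; omega, key a (b - a) (by rw [h]; congr 2; omega)⟩

end frobSymm

/-! ### Counting zeros in the finite field -/

section FiniteField

variable {K : Type*} [Field K] [Fintype K] [DecidableEq K] {q n : ℕ}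

theorem card_filter_pow_eq_self_le {K : Type*} [Field K] [Fintype K] [DecidableEq K] {m : ℕ}
    (hm : 1 < m) : (Finset.univ.filter fun x : K => x ^ m = x).card ≤ m := by
  have h0 := FiniteField.X_pow_card_sub_X_ne_zero K hm
  refine le_trans ?_ ((card_roots' _).trans_eq (FiniteField.X_pow_card_sub_X_natDegree_eq K hm))
  refine le_trans (Finset.card_le_card ?_) (Multiset.toFinset_card_le _)
  intro x hx
  simpa [h0, sub_eq_zero] using hx

/-- A lower bound for the number of zeros in `𝔽_{q^n}`. -/
theorem frobSymm.pow_le_card_zeros (hq : 2 ≤ q) (φ : K →+* K) (hφ : ∀ x, φ x = x ^ q)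
    (hK : Fintype.card K = q ^ n) {i : ℕ} (hi : 1 ≤ i) (hin : i < n) :
    q ^ i ≤ (Finset.univ.filter fun x : K => frobSymm q n i x = 0).card := by
  have hfix (x : K) : x ^ q ^ n = x := by rw [← hK, FiniteField.pow_card]
  -- Inversion is the bijection between the zero sets. The convention 0⁻¹ = 0 is harmless, since 0
  -- is a zero of both.
  have hsymm : (Finset.univ.filter fun x : K => frobSymm q n i x = 0).card =
      (Finset.univ.filter fun x : K => frobSymm q n (n - i) x = 0).card := by
    have hz {k : ℕ} (hk : 1 ≤ k) (hkn : k ≤ n) : frobSymm q n k (0 : K) = 0 := by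
      rw [← eval_nqSymm, nqSymm_eq_frobSymm]
      obtain ⟨u, -, hu⟩ := frobSymm.exists_eq_X_pow_mul (K := K) hq hkn
      have : ∑ j ∈ Finset.range k, q ^ j ≠ 0 :=
        (Finset.sum_pos (fun _ _ => Nat.pow_pos (by omega)) ⟨0, by simp; omega⟩).ne'
      rw [hu]; simp only [eval_mul, eval_pow, eval_X, zero_pow this, zero_mul]
    have hstep {k l : ℕ} (hk : 1 ≤ k) (hl : 1 ≤ l) (hkl : k + l = n) (x : K)
        (hx : frobSymm q n k x = 0) : frobSymm q n l x⁻¹ = 0 := by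
      rcases eq_or_ne x 0 with rfl | hx0
      · rw [inv_zero]; exact hz hl (by omega)
      · have h := frobSymm.reverse q hx0 hkl
        rw [hx] at h
        exact (mul_eq_zero.1 h).resolve_right (Finset.prod_ne_zero_iff.2 fun _ _ => pow_ne_zero _ hx0)
    refine Finset.card_bij' (fun x _ => x⁻¹) (fun x _ => x⁻¹) ?_ ?_ (by simp) (by simp)
    · intro x hx
      simp only [Finset.mem_filter, Finset.mem_univ, true_and] at hx ⊢
      exact hstep hi (by omega) (by omega) x hx
    · intro x hx
      simp only [Finset.mem_filter, Finset.mem_univ, true_and] at hx ⊢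
      exact hstep (by omega) hi (by omega) x hx
  rw [hsymm]
  set g : K → K := frobSymm q n (n - i) with hg
  obtain ⟨hm, hd⟩ := frobSymm.monic_natDegree (K := K) hq (show n - i ≤ n by omega)
  rw [Nat.sub_sub_self (by omega)] at hd
  set D := q ^ i * ∑ j ∈ Finset.range (n - i), q ^ j with hD
  have hDpos : D ≠ 0 := (Nat.mul_pos (Nat.pow_pos (by omega)) (Finset.sum_pos
    (fun _ _ => Nat.pow_pos (by omega)) ⟨0, by simp; omega⟩)).ne'
  have hfib (c : K) : (Finset.univ.filter fun x => g x = c).card ≤ D := by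
    have hne : frobSymm q n (n - i) (X : K[X]) - C c ≠ 0 := by
      intro h
      rw [sub_eq_zero] at h
      rw [h, natDegree_C] at hd
      exact hDpos hd.symm
    rw [← hd, ← natDegree_sub_C (a := c)]
    refine le_trans (Finset.card_le_card ?_) ((Multiset.toFinset_card_le _).trans (card_roots' _))
    intro x hx
    rw [Multiset.mem_toFinset, mem_roots hne, IsRoot, eval_sub, eval_C, ← nqSymm_eq_frobSymm,
      eval_nqSymm, sub_eq_zero]
    simpa using hx
  set S : Finset K := (Finset.univ.filter fun c : K => c ^ q = c) with hS
  have h0S : (0 : K) ∈ S := by simp [hS]; omega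
  -- K is partitioned by the values of g, all in S. At most q - 1 of them are nonzero, each taken at
  -- most D times; the rest of K is the zero fibre.
  have hcard : Fintype.card K = ∑ c ∈ S, (Finset.univ.filter fun x => g x = c).card :=
    Finset.card_eq_sum_card_fiberwise (f := g) (s := Finset.univ) (t := S)
      (fun x _ => by simpa [hS] using frobSymm.pow_eq_self q φ hφ (hfix x) (n - i))
  have hSc : (S.erase 0).card ≤ q - 1 := by
    rw [Finset.card_erase_of_mem h0S]
    exact Nat.sub_le_sub_right (card_filter_pow_eq_self_le (by omega)) 1
  rw [← Finset.add_sum_erase _ _ h0S, hK] at hcard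
  have h1 : ∑ c ∈ S.erase 0, (Finset.univ.filter fun x => g x = c).card ≤ (q - 1) * D :=
    (Finset.sum_le_card_nsmul _ _ _ fun c _ => hfib c).trans
      (by rw [smul_eq_mul]; exact Nat.mul_le_mul_right _ hSc)
  have h2 : (q - 1) * D + q ^ i = q ^ n := by
    have := Nat.geomSum_eq hq (n - i)
    have h3 : (∑ j ∈ Finset.range (n - i), q ^ j) * (q - 1) + 1 = q ^ (n - i) := by
      rw [this, Nat.div_mul_cancel (by simpa using Nat.sub_dvd_pow_sub_pow q 1 (n - i))]
      exact Nat.sub_add_cancel (Nat.pow_pos (by omega))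
    calc (q - 1) * D + q ^ i = q ^ i * ((∑ j ∈ Finset.range (n - i), q ^ j) * (q - 1) + 1) := by
          rw [hD]; ring
      _ = q ^ n := by rw [h3, ← pow_add]; congr 1; omega
  omega

/-- The polynomial `s_{n,i}` has a simple zero in `𝔽_{q^n}`. -/
theorem exists_simple_root_nqSymm (hq : 2 ≤ q) (φ : K →+* K) (hφ : ∀ x, φ x = x ^ q)
    (ψ : K[X] →+* K[X]) (hψ : ∀ x, ψ x = x ^ q) (hq0 : (q : K) = 0)
    (hK : Fintype.card K = q ^ n) {i : ℕ} (hi : 1 ≤ i) (hin : i < n) :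
    ∃ α : K, (nqSymm K q n i).eval α = 0 ∧ (derivative (nqSymm K q n i)).eval α ≠ 0 := by
  by_contra! hcon
  have hfix (x : K) : x ^ q ^ n = x := by rw [← hK, FiniteField.pow_card]
  obtain ⟨m, rfl⟩ := Nat.exists_eq_succ_of_ne_zero (show n ≠ 0 by omega)
  obtain ⟨k, rfl⟩ := Nat.exists_eq_succ_of_ne_zero (show i ≠ 0 by omega)
  -- With k = i - 1: if every zero is multiple, each satisfies x^(q^d) = x for some 1 ≤ d ≤ k. This
  -- allows at most q + … + q^k < q^(k+1) = q^i zeros.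
  have hsub : (Finset.univ.filter fun x : K => frobSymm q (m + 1) (k + 1) x = 0) ⊆
      (Finset.Icc 1 k).biUnion fun d => Finset.univ.filter fun x : K => x ^ q ^ d = x := by
    intro x hx
    simp only [Finset.mem_filter, Finset.mem_univ, true_and] at hx
    have h := hcon x (by rw [eval_nqSymm]; exact hx)
    rw [nqSymm_eq_frobSymm, Nat.succ_eq_add_one, Nat.succ_eq_add_one,
      frobSymm.derivative_eq q ψ hψ hq0, ← coe_evalRingHom, frobSymm.map, coe_evalRingHom,
      eval_pow, eval_X] at h
    obtain ⟨d, hd, hxd⟩ := frobSymm.exists_pow_eq_self q φ hφ (hfix x) h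
    simp only [Finset.mem_biUnion, Finset.mem_filter, Finset.mem_univ, true_and]
    exact ⟨d, hd, hxd⟩
  have h1 := (frobSymm.pow_le_card_zeros hq φ hφ hK hi hin).trans (Finset.card_le_card hsub)
  have h2 : ((Finset.Icc 1 k).biUnion fun d => Finset.univ.filter
      fun x : K => x ^ q ^ d = x).card ≤ ∑ d ∈ Finset.Icc 1 k, q ^ d :=
    Finset.card_biUnion_le.trans (Finset.sum_le_sum fun d hd => card_filter_pow_eq_self_le
      (Nat.one_lt_pow (by rw [Finset.mem_Icc] at hd; omega) (by omega)))
  have h3 : ∑ d ∈ Finset.Icc 1 k, q ^ d ≤ ∑ d ∈ Finset.range (k + 1), q ^ d :=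
    Finset.sum_le_sum_of_subset fun d hd => by
      rw [Finset.mem_Icc] at hd; rw [Finset.mem_range]; omega
  have h4 := geom_sum_lt_pow hq (k + 1)
  exact absurd (h1.trans (h2.trans h3)) (not_le.2 h4)

end FiniteField

/-! ### Valuation rings and discrete places -/

open IsDedekindDomain WithZero in
/-- A proper valuation ring of the fraction field of a Dedekind domain `A` that contains `A` is
the localization of `A` at its center. -/
theorem ValuationSubring.exists_eq_valuationSubring (A : Type*) [CommRing A] [IsDedekindDomain A]
    {E : Type*} [Field E] [Algebra A E] [IsFractionRing A E] {V : ValuationSubring E}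
    (hA : ∀ a, algebraMap A E a ∈ V) (hV : V ≠ ⊤) :
    ∃ p : HeightOneSpectrum A, V = (p.valuation E).valuationSubring := by
  let f : A →+* V := (algebraMap A E).codRestrict V hA
  have hmem (a : A) : a ∈ (IsLocalRing.maximalIdeal V).comap f ↔ algebraMap A E a ∈ V.nonunits := by
    rw [Ideal.mem_comap, ← ValuationSubring.coe_mem_nonunits_iff]
    rfl
  have hunit {a : A} (ha : a ∉ (IsLocalRing.maximalIdeal V).comap f) :
      (algebraMap A E a)⁻¹ ∈ V := by
    rw [hmem, ValuationSubring.mem_nonunits_iff_or] at ha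
    push Not at ha
    exact ha.2
  -- If the center were zero, all nonzero elements of A would be units of V, and V would contain
  -- every fraction.
  have hbot : (IsLocalRing.maximalIdeal V).comap f ≠ ⊥ := by
    intro h
    apply hV
    rw [_root_.eq_top_iff]
    intro z _
    obtain ⟨a, b, hb, rfl⟩ := IsFractionRing.div_surjective (A := A) z
    rw [div_eq_mul_inv]
    refine V.mul_mem _ _ (hA a) (hunit ?_)
    rw [h, Ideal.mem_bot]
    exact nonZeroDivisors.ne_zero hb
  let p : HeightOneSpectrum A := ⟨_, Ideal.comap_isPrime f _, hbot⟩
  refine ⟨p, ?_⟩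
  rw [← HeightOneSpectrum.valuationSubringAtPrime_eq_valuationSubring]
  -- A discrete valuation ring is maximal among proper subrings of its field, so the inclusion of
  -- the localization in V suffices.
  refine (ValuationSubring.eq_of_le_of_ne_top _ ?_ hV).symm
  rintro _ ⟨a, s, hs, rfl⟩
  exact V.mul_mem _ _ (hA a) (hunit hs)

namespace FFPlace

open WithZero

variable {K L : Type*} [Field K] [Field L] [Algebra K L]

/-- The place is discrete: its valuation ring is that of a normalized discrete valuation. -/
def IsDiscrete (P : FFPlace K L) : Prop :=
  ∃ v : Valuation L ℤᵐ⁰, Function.Surjective v ∧ P.ring = v.valuationSubring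

theorem mem_nonunits_iff_of_ring_eq {P : FFPlace K L} {v : Valuation L ℤᵐ⁰}
    (hP : P.ring = v.valuationSubring) (f : L) : f ∈ P.ring.nonunits ↔ v f < 1 := by
  rw [hP, ValuationSubring.mem_nonunits_iff]
  exact (v.isEquiv_valuation_valuationSubring.lt_one_iff_lt_one).symm

theorem isUnit_of_valuation_eq_one {P : FFPlace K L} {v : Valuation L ℤᵐ⁰}
    (hP : P.ring = v.valuationSubring) {f : P.ring} (hf : v f = 1) : IsUnit f := by
  have h : (f : L)⁻¹ ∈ P.ring := (congrArg ((f : L)⁻¹ ∈ ·) hP).mpr (by simp [hf])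
  have h0 : (f : L) ≠ 0 := fun h => by simp [h] at hf
  exact IsUnit.of_mul_eq_one ⟨_, h⟩ (Subtype.ext (mul_inv_cancel₀ h0))

/-- Bridge between orders defined by local parameters and multiplicative valuations, where order k
becomes `exp (-k)`. -/
theorem hasOrd_of_valuation {P : FFPlace K L} {v : Valuation L ℤᵐ⁰} (hv : Function.Surjective v)
    (hP : P.ring = v.valuationSubring) {f : L} {k : ℤ} (hf : v f = exp (-k)) : P.HasOrd f k := by
  obtain ⟨t, ht⟩ := hv (exp (-1))
  have hmem {z : L} : z ∈ P.ring ↔ v z ≤ 1 := by rw [hP]; rfl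
  have ht0 : t ≠ 0 := fun h => by rw [h, map_zero] at ht; exact exp_ne_zero ht.symm
  have htlt : v t < 1 := by rw [ht, ← exp_zero, exp_lt_exp]; omega
  have htP : t ∈ P.ring := hmem.2 htlt.le
  have hu : v (f / t ^ k) = 1 := by
    rw [map_div₀, map_zpow₀, hf, ht, ← exp_zsmul, ← exp_sub, ← exp_zero]; congr 1; simp
  refine ⟨⟨t, htP⟩, ?_, (isUnit_of_valuation_eq_one hP (f := ⟨f / t ^ k, hmem.2 hu.le⟩) hu).unit, ?_⟩
  · ext z
    rw [Ideal.mem_span_singleton, ← ValuationSubring.coe_mem_nonunits_iff,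
      mem_nonunits_iff_of_ring_eq hP]
    constructor
    · intro hz
      refine ⟨⟨z / t, hmem.2 ?_⟩, Subtype.ext (by simp; field_simp)⟩
      rw [map_div₀, ht]
      rcases eq_or_ne (v (z : L)) 0 with h0 | h0
      · simp [h0]
      · rw [← exp_log h0, ← exp_sub, ← exp_zero, exp_le_exp]
        rw [← exp_log h0, ← exp_zero, exp_lt_exp] at hz
        omega
    · rintro ⟨c, rfl⟩
      have hc : v (c : L) ≤ 1 := hmem.1 c.2
      simpa using mul_lt_one_of_lt_of_le htlt hc
  · simp
    field_simp

theorem valuation_eq_exp {P : FFPlace K L} {v : Valuation L ℤᵐ⁰} (hv : Function.Surjective v)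
    (hP : P.ring = v.valuationSubring) {f : L} (hf : f ≠ 0) : v f = exp (-P.ord f) := by
  have h0 : v f ≠ 0 := (Valuation.ne_zero_iff v).2 hf
  have h : v f = exp (-(-log (v f))) := by rw [neg_neg, exp_log h0]
  rw [(hasOrd_of_valuation hv hP h).ord_eq, ← h]

theorem ord_eq_of_valuation {P : FFPlace K L} {v : Valuation L ℤᵐ⁰} (hv : Function.Surjective v)
    (hP : P.ring = v.valuationSubring) {f : L} {k : ℤ} (hf : v f = exp (-k)) : P.ord f = k :=
  (hasOrd_of_valuation hv hP hf).ord_eq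

namespace IsDiscrete

variable {P : FFPlace K L} (hP : P.IsDiscrete)
include hP

theorem ord_mul {f g : L} (hf : f ≠ 0) (hg : g ≠ 0) : P.ord (f * g) = P.ord f + P.ord g := by
  obtain ⟨v, hv, hP⟩ := hP
  apply ord_eq_of_valuation hv hP
  rw [map_mul, valuation_eq_exp hv hP hf, valuation_eq_exp hv hP hg, ← exp_add, neg_add]

theorem ord_zpow {f : L} (hf : f ≠ 0) (k : ℤ) : P.ord (f ^ k) = k * P.ord f := by
  obtain ⟨v, hv, hP⟩ := hP
  apply ord_eq_of_valuation hv hP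
  rw [map_zpow₀, valuation_eq_exp hv hP hf, ← exp_zsmul, smul_eq_mul, mul_neg]

theorem ord_pow {f : L} (hf : f ≠ 0) (k : ℕ) : P.ord (f ^ k) = k * P.ord f := by
  rw [← zpow_natCast, hP.ord_zpow hf]

theorem mem_ring_iff {f : L} (hf : f ≠ 0) : f ∈ P.ring ↔ 0 ≤ P.ord f := by
  obtain ⟨v, hv, hP⟩ := hP
  rw [hP, Valuation.mem_valuationSubring_iff, valuation_eq_exp hv hP hf, ← exp_zero, exp_le_exp]
  omega

theorem mem_nonunits_iff {f : L} (hf : f ≠ 0) : f ∈ P.ring.nonunits ↔ 0 < P.ord f := by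
  obtain ⟨v, hv, hP⟩ := hP
  rw [mem_nonunits_iff_of_ring_eq hP, valuation_eq_exp hv hP hf, ← exp_zero, exp_lt_exp]
  omega

theorem exists_ord_eq_one : ∃ t : L, t ≠ 0 ∧ P.ord t = 1 := by
  obtain ⟨v, hv, hP⟩ := hP
  obtain ⟨t, ht⟩ := hv (exp (-1))
  refine ⟨t, ?_, ord_eq_of_valuation hv hP ht⟩
  rintro rfl
  rw [map_zero] at ht
  exact exp_ne_zero ht.symm

theorem isDiscreteValuationRing : IsDiscreteValuationRing P.ring := by
  obtain ⟨t, ht0, ht⟩ := hP.exists_ord_eq_one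
  have htn : t ∈ P.ring.nonunits := (hP.mem_nonunits_iff ht0).2 (by omega)
  have htP : t ∈ P.ring := ValuationSubring.nonunits_subset htn
  have hunit {f : P.ring} (h0 : (f : L) ≠ 0) (hf : P.ord f = 0) : IsUnit f := by
    have h1 := mt (hP.mem_nonunits_iff h0).1 (by omega)
    rw [ValuationSubring.coe_mem_nonunits_iff, IsLocalRing.notMem_maximalIdeal] at h1
    exact h1
  apply IsDiscreteValuationRing.ofHasUnitMulPowIrreducibleFactorization
  have hnu : ¬ IsUnit (⟨t, htP⟩ : P.ring) := by
    rw [← _root_.mem_nonunits_iff, ← IsLocalRing.mem_maximalIdeal, ← ValuationSubring.coe_mem_nonunits_iff]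
    exact htn
  refine ⟨⟨t, htP⟩, ⟨hnu, ?_⟩, ?_⟩
  · intro a b hab
    have hab' : t = a * b := congrArg Subtype.val hab
    have ha : (a : L) ≠ 0 := left_ne_zero_of_mul (hab' ▸ ht0)
    have hb : (b : L) ≠ 0 := right_ne_zero_of_mul (hab' ▸ ht0)
    have h := hP.ord_mul ha hb
    rw [← hab', ht] at h
    have h1 := (hP.mem_ring_iff ha).1 a.2
    have h2 := (hP.mem_ring_iff hb).1 b.2
    rcases Int.le_iff_lt_or_eq.1 h1 with h3 | h3
    · exact Or.inr (hunit hb (by omega))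
    · exact Or.inl (hunit ha h3.symm)
  · intro x hx
    have hx0 : (x : L) ≠ 0 := fun h => hx (Subtype.ext h)
    have h1 := (hP.mem_ring_iff hx0).1 x.2
    obtain ⟨k, hk⟩ := Int.eq_ofNat_of_zero_le h1
    have hu : P.ord ((x : L) / t ^ k) = 0 := by
      rw [div_eq_mul_inv, ← zpow_natCast, ← zpow_neg, hP.ord_mul hx0 (zpow_ne_zero _ ht0),
        hP.ord_zpow ht0, ht, hk]
      simp
    have hq0 : (x : L) / t ^ k ≠ 0 := div_ne_zero hx0 (pow_ne_zero _ ht0)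
    have hu' := hunit (f := ⟨x / t ^ k, (hP.mem_ring_iff hq0).2 hu.ge⟩) hq0 hu
    refine ⟨k, hu'.unit, Subtype.ext ?_⟩
    simp
    field_simp

end IsDiscrete

/-! ### Places of the rational function field -/

section RatFunc

variable {K : Type*} [Field K]

theorem isDiscrete_infty : (infty K).IsDiscrete := by
  classical
  refine ⟨RatFunc.inftyValuation K, fun c => ?_, ?_⟩
  · rcases eq_or_ne c 0 with rfl | hc
    · exact ⟨0, map_zero _⟩
    · exact ⟨RatFunc.X ^ log c, by rw [RatFunc.inftyValuation.X_zpow, exp_log hc]⟩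
  · rw [infty]

theorem ord_infty {p : K[X]} (hp : p ≠ 0) :
    (infty K).ord (algebraMap K[X] (RatFunc K) p) = -(p.natDegree : ℤ) := by
  classical
  have h : (infty K).ring = (RatFunc.inftyValuation K).valuationSubring := by rw [infty]
  refine ord_eq_of_valuation (fun c => ?_) h ?_
  · rcases eq_or_ne c 0 with rfl | hc
    · exact ⟨0, map_zero _⟩
    · exact ⟨RatFunc.X ^ log c, by rw [RatFunc.inftyValuation.X_zpow, exp_log hc]⟩
  · rw [RatFunc.inftyValuation_apply, RatFunc.inftyValuation.polynomial _ hp, neg_neg]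

theorem isDiscrete_of_ring_eq {A : Type*} [CommRing A] [IsDedekindDomain A] {L : Type*} [Field L]
    [Algebra K L] [Algebra A L] [IsFractionRing A L] {P : FFPlace K L}
    {p : IsDedekindDomain.HeightOneSpectrum A}
    (h : P.ring = (p.valuation L).valuationSubring) : P.IsDiscrete :=
  ⟨_, p.valuation_surjective L, h⟩

/-- If x is in the valuation ring, so is K[x], and the place has a center there. Otherwise x has
valuation greater than 1, which determines the valuation up to equivalence. -/
theorem eq_infty_or_exists (P : FFPlace K (RatFunc K)) : P = infty K ∨
    ∃ p : IsDedekindDomain.HeightOneSpectrum K[X],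
      P.ring = (p.valuation (RatFunc K)).valuationSubring := by
  classical
  by_cases hX : (RatFunc.X : RatFunc K) ∈ P.ring
  · right
    refine ValuationSubring.exists_eq_valuationSubring K[X] (fun a => ?_) P.ne_top
    induction a using Polynomial.induction_on' with
    | add p q hp hq => rw [map_add]; exact add_mem hp hq
    | monomial n c =>
      rw [← C_mul_X_pow_eq_monomial, map_mul, map_pow, RatFunc.algebraMap_X, RatFunc.algebraMap_C,
        ← RatFunc.algebraMap_eq_C]
      exact mul_mem (P.const_mem c) (pow_mem hX n)
  · left
    have hlt : 1 < P.ring.valuation RatFunc.X := by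
      rw [← not_le, ValuationSubring.valuation_le_one_iff]; exact hX
    have : P.ring.valuation.IsTrivialOn K := ⟨fun a ha => by
      refine le_antisymm ((P.ring.valuation_le_one_iff _).2 (P.const_mem a)) ?_
      have h := (P.ring.valuation_le_one_iff _).2 (P.const_mem a⁻¹)
      rw [map_inv₀, map_inv₀] at h
      exact (inv_le_one₀ (zero_lt_iff.2 ((Valuation.ne_zero_iff _).2 (by simpa using ha)))).1 h⟩
    have h := RatFunc.valuation_isEquiv_inftyValuation_of_one_lt_valuation_X hlt
    rw [Valuation.isEquiv_iff_valuationSubring, ValuationSubring.valuationSubring_valuation] at h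
    ext1
    rw [h, infty]

theorem isDiscrete (P : FFPlace K (RatFunc K)) : P.IsDiscrete := by
  rcases P.eq_infty_or_exists with rfl | ⟨p, hp⟩
  · exact isDiscrete_infty
  · exact isDiscrete_of_ring_eq hp

theorem ord_zeroOf {α : K} {u : K[X]} (hu : u.eval α ≠ 0) (k : ℕ) :
    (zeroOf α).ord (algebraMap K[X] (RatFunc K) ((X - C α) ^ k * u)) = k := by
  refine ord_eq_of_valuation ((idealXSub α).valuation_surjective (RatFunc K)) rfl ?_
  rw [map_mul, map_mul, map_pow, map_pow]
  have h1 : (idealXSub α).valuation (RatFunc K) (algebraMap K[X] _ u) = 1 := by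
    rw [IsDedekindDomain.HeightOneSpectrum.valuation_eq_one_iff_notMem]
    intro h
    exact hu (dvd_iff_isRoot.1 (Ideal.mem_span_singleton.1 h))
  have h2 : (idealXSub α).valuation (RatFunc K) (algebraMap K[X] _ (X - C α)) = exp (-1 : ℤ) := by
    rw [IsDedekindDomain.HeightOneSpectrum.valuation_of_algebraMap]
    exact (idealXSub α).intValuation_singleton (X_sub_C_ne_zero α) rfl
  rw [h1, h2, mul_one, ← exp_nsmul]
  simp

theorem ord_polynomial_nonneg {P : FFPlace K (RatFunc K)} (hP : P ≠ infty K) {f : K[X]}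
    (hf : f ≠ 0) : 0 ≤ P.ord (algebraMap K[X] (RatFunc K) f) := by
  obtain ⟨p, hp⟩ := P.eq_infty_or_exists.resolve_left hP
  rw [← P.isDiscrete.mem_ring_iff (by simpa using hf), hp]
  exact p.valuation_le_one f

/-- At a finite place of order k, the k-th power of a generator of the prime, which has positive
degree, divides f. At infinity the order is not positive. -/
theorem ord_polynomial_le {P : FFPlace K (RatFunc K)} {f : K[X]} (hf : f ≠ 0) :
    P.ord (algebraMap K[X] (RatFunc K) f) ≤ f.natDegree := by
  rcases P.eq_infty_or_exists with rfl | ⟨p, hp⟩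
  · rw [ord_infty hf]; omega
  have hs := p.valuation_surjective (RatFunc K)
  have hnn : 0 ≤ P.ord (algebraMap K[X] (RatFunc K) f) := by
    rw [← P.isDiscrete.mem_ring_iff (by simpa using hf), hp]
    exact p.valuation_le_one f
  obtain ⟨k, hk⟩ := Int.eq_ofNat_of_zero_le hnn
  have h := valuation_eq_exp hs hp (f := algebraMap K[X] (RatFunc K) f) (by simpa using hf)
  rw [hk, p.valuation_of_algebraMap] at h
  have hmem := (p.intValuation_le_pow_iff_mem f k).1 h.le
  obtain ⟨g, hg⟩ := (IsPrincipalIdealRing.principal p.asIdeal).principal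
  rw [hg, Ideal.submodule_span_eq, Ideal.span_singleton_pow, Ideal.mem_span_singleton] at hmem
  have hd := natDegree_le_of_dvd hmem hf
  have hg0 : g ≠ 0 := by
    rintro rfl
    exact p.ne_bot (by rw [hg]; simp)
  have hgd : 0 < g.natDegree := by
    rw [pos_iff_ne_zero]
    intro h0
    rw [natDegree_eq_zero] at h0
    obtain ⟨c, rfl⟩ := h0
    apply p.isPrime.ne_top
    rw [hg, Ideal.submodule_span_eq, Ideal.span_singleton_eq_top, isUnit_C]
    exact (C_ne_zero.1 hg0).isUnit
  rw [natDegree_pow] at hd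
  rw [hk]
  have : k ≤ k * g.natDegree := Nat.le_mul_of_pos_right k hgd
  exact_mod_cast this.trans hd

end RatFunc

end FFPlace

/-! ### Places in extensions and integral closures -/

namespace FFPlace

section Extension

variable {K F E : Type*} [Field K] [Field F] [Field E] [Algebra K F] [Algebra F E]

theorem LiesOver.mem_ring_iff [Algebra K E] {P' : FFPlace K E} {P : FFPlace K F} (h : P'.LiesOver P) {z : F} :
    algebraMap F E z ∈ P'.ring ↔ z ∈ P.ring := by
  rw [← show P'.ring.comap (algebraMap F E) = P.ring from h, ValuationSubring.mem_comap]

theorem LiesOver.mem_nonunits_iff [Algebra K E] {P' : FFPlace K E} {P : FFPlace K F} (h : P'.LiesOver P) {z : F} :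
    algebraMap F E z ∈ P'.ring.nonunits ↔ z ∈ P.ring.nonunits := by
  rw [ValuationSubring.mem_nonunits_iff_or, ValuationSubring.mem_nonunits_iff_or, ← map_inv₀,
    h.mem_ring_iff, map_eq_zero]

/-- Some valuation ring of E dominates 𝒪_P. Domination forces the intersection with F to be 𝒪_P: for
z outside 𝒪_P, the nonunit z⁻¹ would otherwise become a unit. -/
theorem exists_liesOver [Algebra K E] [IsScalarTower K F E] (P : FFPlace K F) :
    ∃ P' : FFPlace K E, P'.LiesOver P := by
  obtain ⟨B, hB, hloc⟩ := IsLocalRing.exists_factor_valuationRing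
    ((algebraMap F E).comp P.ring.subtype)
  have hcomap : B.comap (algebraMap F E) = P.ring := by
    ext z
    rw [ValuationSubring.mem_comap]
    refine ⟨fun hz => ?_, fun hz => hB ⟨z, hz⟩⟩
    by_contra hzP
    have hz0 : z ≠ 0 := by rintro rfl; exact hzP (zero_mem _)
    have hinv := (P.ring.mem_or_inv_mem z).resolve_left hzP
    have hunit : IsUnit (⟨z⁻¹, hinv⟩ : P.ring) := by
      apply hloc.map_nonunit
      refine IsUnit.of_mul_eq_one ⟨algebraMap F E z, hz⟩ (Subtype.ext ?_)
      change algebraMap F E z⁻¹ * algebraMap F E z = 1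
      rw [← map_mul, inv_mul_cancel₀ hz0, map_one]
    obtain ⟨b, hb⟩ := hunit.exists_right_inv
    have hb' : z⁻¹ * (b : F) = 1 := congrArg Subtype.val hb
    have : z = b := by field_simp at hb'; exact hb'.symm
    exact hzP (this ▸ b.2)
  refine ⟨⟨B, fun c => ?_, fun h => P.ne_top ?_⟩, hcomap⟩
  · rw [IsScalarTower.algebraMap_apply K F E]
    exact hB ⟨_, P.const_mem c⟩
  · rw [← hcomap, h]
    ext z
    simp

namespace IsIntegralAt

variable {P : FFPlace K F} {z w : E}

theorem of_mem {f : F} (hf : f ∈ P.ring) : P.IsIntegralAt (algebraMap F E f) :=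
  RingHom.isIntegralElem_map _ (x := (⟨f, hf⟩ : P.ring))

theorem zero : P.IsIntegralAt (0 : E) := RingHom.isIntegralElem_zero _

theorem add (hz : P.IsIntegralAt z) (hw : P.IsIntegralAt w) : P.IsIntegralAt (z + w) :=
  RingHom.IsIntegralElem.add _ hz hw

theorem neg (hz : P.IsIntegralAt z) : P.IsIntegralAt (-z) := RingHom.IsIntegralElem.neg _ hz

theorem mul (hz : P.IsIntegralAt z) (hw : P.IsIntegralAt w) : P.IsIntegralAt (z * w) :=
  RingHom.IsIntegralElem.mul _ hz hw

theorem sum {ι : Type*} {s : Finset ι} {f : ι → E} (h : ∀ i ∈ s, P.IsIntegralAt (f i)) :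
    P.IsIntegralAt (∑ i ∈ s, f i) :=
  Finset.sum_induction f P.IsIntegralAt (fun _ _ => add) zero h

theorem of_pow {n : ℕ} (hn : 0 < n) (hz : P.IsIntegralAt (z ^ n)) : P.IsIntegralAt z := by
  obtain ⟨p, hp, h⟩ := hz
  refine ⟨Polynomial.expand _ n p, hp.expand hn, ?_⟩
  rw [← h, eval₂_eq_eval_map, eval₂_eq_eval_map, map_expand, expand_eval]

theorem const [Algebra K E] [IsScalarTower K F E] (c : K) : P.IsIntegralAt (algebraMap K E c) := by
  rw [IsScalarTower.algebraMap_apply K F E]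
  exact of_mem (P.const_mem c)

theorem map (σ : E ≃ₐ[F] E) (hz : P.IsIntegralAt z) : P.IsIntegralAt (σ z) := by
  obtain ⟨p, hp, h⟩ := hz
  refine ⟨p, hp, ?_⟩
  have h2 := congrArg (σ : E →+* E) h
  rw [hom_eval₂, map_zero] at h2
  rw [← h2]
  congr 1
  ext x
  simp

theorem mem_ring [Algebra K E] (hz : P.IsIntegralAt z) {P' : FFPlace K E} (h : P'.LiesOver P) :
    z ∈ P'.ring := by
  obtain ⟨p, hp, h0⟩ := hz
  have : IsIntegral P'.ring z := by
    refine ⟨p.map (((algebraMap F E).comp P.ring.subtype).codRestrict P'.ring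
      fun x => h.mem_ring_iff.2 x.2), hp.map _, ?_⟩
    rw [eval₂_map, ← h0]
    rfl
  obtain ⟨x, hx⟩ := IsIntegrallyClosed.isIntegral_iff.1 this
  exact hx ▸ x.2

end IsIntegralAt

theorem IsDiscrete.isDedekindDomain_integralClosure [FiniteDimensional F E]
    [Algebra.IsSeparable F E] {P : FFPlace K F} (hP : P.IsDiscrete) :
    IsDedekindDomain (integralClosure P.ring E) := by
  have := hP.isDiscreteValuationRing
  exact integralClosure.isDedekindDomain P.ring F E

theorem LiesOver.exists_ring_eq [Algebra K E] {P : FFPlace K F} {P' : FFPlace K E}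
    (h : P'.LiesOver P) [IsDedekindDomain (integralClosure P.ring E)]
    [IsFractionRing (integralClosure P.ring E) E] :
    ∃ p : IsDedekindDomain.HeightOneSpectrum (integralClosure P.ring E),
      P'.ring = (p.valuation E).valuationSubring :=
  ValuationSubring.exists_eq_valuationSubring _
    (fun a => IsIntegralAt.mem_ring (P := P) a.2 h) P'.ne_top

section Finite

variable [Algebra K E] [FiniteDimensional F E] [Algebra.IsSeparable F E] {P : FFPlace K F}

theorem IsDiscrete.of_liesOver (hP : P.IsDiscrete) {P' : FFPlace K E} (h : P'.LiesOver P) :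
    P'.IsDiscrete := by
  have := hP.isDedekindDomain_integralClosure (E := E)
  have := integralClosure.isFractionRing_of_finite_extension (A := P.ring) F E
  obtain ⟨p, hp⟩ := h.exists_ring_eq
  exact isDiscrete_of_ring_eq hp

/-- A place above `P` is determined by its center on the integral closure of `𝒪_P`. -/
theorem LiesOver.eq_of_nonunits (hP : P.IsDiscrete) {P₁ P₂ : FFPlace K E} (h₁ : P₁.LiesOver P)
    (h₂ : P₂.LiesOver P)
    (h : ∀ z : E, P.IsIntegralAt z → z ∈ P₁.ring.nonunits → z ∈ P₂.ring.nonunits) : P₁ = P₂ := by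
  have := hP.isDedekindDomain_integralClosure (E := E)
  have := integralClosure.isFractionRing_of_finite_extension (A := P.ring) F E
  obtain ⟨p₁, hp₁⟩ := h₁.exists_ring_eq
  obtain ⟨p₂, hp₂⟩ := h₂.exists_ring_eq
  -- Inclusion of the centers is enough, because nonzero primes of a Dedekind domain are maximal.
  have hle : p₁.asIdeal ≤ p₂.asIdeal := by
    intro z hz
    rw [← p₂.valuation_lt_one_iff_mem (K := E), ← mem_nonunits_iff_of_ring_eq hp₂]
    apply h _ z.2
    rw [mem_nonunits_iff_of_ring_eq hp₁]
    exact (p₁.valuation_lt_one_iff_mem z).2 hz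
  have heq : p₁ = p₂ := IsDedekindDomain.HeightOneSpectrum.ext
    (p₁.isMaximal.eq_of_le p₂.isPrime.ne_top hle)
  ext1
  rw [hp₁, hp₂, heq]

theorem LiesOver.ord_algebraMap (hP : P.IsDiscrete) {P' : FFPlace K E} (h : P'.LiesOver P) {t : F}
    (ht0 : t ≠ 0) (ht : P.ord t = 1) {z : F} (hz : z ≠ 0) :
    P'.ord (algebraMap F E z) = P'.ord (algebraMap F E t) * P.ord z := by
  have hP' := hP.of_liesOver h
  have hinj {f : F} (hf : f ≠ 0) : algebraMap F E f ≠ 0 := by simpa using hf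
  have hu0 : z * t ^ (-P.ord z) ≠ 0 := mul_ne_zero hz (zpow_ne_zero _ ht0)
  have hu : P.ord (z * t ^ (-P.ord z)) = 0 := by
    rw [hP.ord_mul hz (zpow_ne_zero _ ht0), hP.ord_zpow ht0, ht]; ring
  have h1 := h.mem_ring_iff.2 ((hP.mem_ring_iff hu0).2 hu.ge)
  rw [hP'.mem_ring_iff (hinj hu0)] at h1
  have h2 := mt h.mem_nonunits_iff.1 (mt (hP.mem_nonunits_iff hu0).1 (by omega))
  rw [hP'.mem_nonunits_iff (hinj hu0)] at h2
  have h3 : P'.ord (algebraMap F E (z * t ^ (-P.ord z))) = 0 := by omega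
  rw [map_mul, map_zpow₀, hP'.ord_mul (hinj hz) (zpow_ne_zero _ (hinj ht0)),
    hP'.ord_zpow (hinj ht0)] at h3
  linarith

/-- The order at P' of a local parameter of P is a valid positive index, so `ramIdx` does not take
its default value 0. -/
theorem LiesOver.ord_algebraMap_eq_ramIdx_mul (hP : P.IsDiscrete) {P' : FFPlace K E}
    (h : P'.LiesOver P) {z : F} (hz : z ≠ 0) :
    P'.ord (algebraMap F E z) = P'.ramIdx P * P.ord z := by
  obtain ⟨t, ht0, ht⟩ := hP.exists_ord_eq_one
  have ht0' : algebraMap F E t ≠ 0 := by simpa using ht0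
  have hpos : 0 < P'.ord (algebraMap F E t) := by
    rw [← (hP.of_liesOver h).mem_nonunits_iff ht0', h.mem_nonunits_iff, hP.mem_nonunits_iff ht0, ht]
    exact one_pos
  obtain ⟨e, he⟩ := Int.eq_ofNat_of_zero_le hpos.le
  have key : ∀ z : F, z ≠ 0 → P'.ord (algebraMap F E z) = e * P.ord z := fun z hz => by
    rw [h.ord_algebraMap hP ht0 ht hz, he]
  rw [ramIdx_eq (by omega) key ht0 (by omega)]
  exact key z hz

end Finite

end Extension

end FFPlace

/-! ### Local theory of Kummer extensions -/

/-- The automorphism `σ : y ↦ ξ y` generates the Galois group of the Kummer extension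
`E = F(y)` with `y ^ m = s`, where `ξ ∈ K ⊆ F` is a primitive `m`-th root of unity. -/
structure IsKummerGenerator {K F E : Type*} [Field K] [Field F] [Field E] [Algebra K F]
    [Algebra K E] [Algebra F E] (m : ℕ) (ξ : K) (s : F) (y : E) (σ : E ≃ₐ[F] E) : Prop where
  pos : 0 < m
  natCast_ne_zero : (m : K) ≠ 0
  prim : IsPrimitiveRoot ξ m
  ne_zero : s ≠ 0
  pow_eq : y ^ m = algebraMap F E s
  map_eq : σ y = algebraMap K E ξ * y
  fixed : ∀ z : E, σ z = z → ∃ a : F, algebraMap F E a = z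
  pow_eq_one : σ ^ m = 1
  trace_eq : ∀ z : E, algebraMap F E (Algebra.trace F E z) = ∑ k ∈ Finset.range m, (σ ^ k) z

theorem AlgEquiv.apply_algebraMap_of_isScalarTower {K F E : Type*} [Field K] [Field F] [Field E]
    [Algebra K F] [Algebra K E] [Algebra F E] [IsScalarTower K F E] (σ : E ≃ₐ[F] E) (c : K) :
    σ (algebraMap K E c) = algebraMap K E c := by
  rw [IsScalarTower.algebraMap_apply K F E, AlgEquiv.commutes]

namespace IsKummerGenerator

variable {K F E : Type*} [Field K] [Field F] [Field E] [Algebra K F] [Algebra K E] [Algebra F E]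
  {m : ℕ} {ξ : K} {s : F} {y : E} {σ : E ≃ₐ[F] E}
  (h : IsKummerGenerator m ξ s y σ)
include h

theorem y_ne_zero : y ≠ 0 := by
  rintro rfl
  have h1 := h.pow_eq
  rw [zero_pow h.pos.ne', eq_comm, map_eq_zero] at h1
  exact h.ne_zero h1

theorem ξ_ne_zero : ξ ≠ 0 := h.prim.ne_zero h.pos.ne'

theorem inv_pow_eq_one : ξ⁻¹ ^ m = 1 := by rw [inv_pow, h.prim.pow_eq_one, inv_one]

/-- An eigenvector of `σ` is of the form `a y ^ j`. -/
theorem exists_eq_mul_pow {z : E} {j : ℕ} (hz : σ z = algebraMap K E (ξ ^ j) * z) :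
    ∃ a : F, z = algebraMap F E a * y ^ j := by
  have hy : y ^ j ≠ 0 := pow_ne_zero _ h.y_ne_zero
  have hξ : algebraMap K E ξ ≠ 0 := by simpa using h.ξ_ne_zero
  obtain ⟨a, ha⟩ := h.fixed (z / y ^ j) (by
    rw [map_div₀, map_pow, h.map_eq, hz, mul_pow, map_pow, mul_div_mul_left _ _ (pow_ne_zero _ hξ)])
  exact ⟨a, by rw [ha, div_mul_cancel₀ _ hy]⟩

theorem sum_inv_pow {k : ℕ} (hk : k < m) (hk0 : k ≠ 0) :
    ∑ j ∈ Finset.range m, (ξ⁻¹ ^ j) ^ k = 0 := by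
  have h1 : ξ⁻¹ ^ k ≠ 1 := by
    rw [inv_pow, Ne, inv_eq_one]
    exact h.prim.pow_ne_one_of_pos_of_lt hk0 hk
  have h2 := mul_geom_sum (ξ⁻¹ ^ k) m
  rw [← pow_mul, mul_comm k m, pow_mul, h.inv_pow_eq_one, one_pow, sub_self] at h2
  rw [← (mul_eq_zero.1 h2).resolve_left (sub_ne_zero.2 h1)]
  exact Finset.sum_congr rfl fun j _ => by rw [← pow_mul, ← pow_mul, mul_comm]

/-- Decomposition into eigenvectors: inclusions of `σ`-stable subgroups can be checked on
the elements `a y ^ j`. -/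
theorem le_of_eigenvectors [IsScalarTower K F E] {S T : AddSubgroup E} (hS : ∀ (c : K), ∀ z ∈ S, algebraMap K E c * z ∈ S)
    (hσ : ∀ z ∈ S, σ z ∈ S)
    (hST : ∀ (a : F) (j : ℕ), algebraMap F E a * y ^ j ∈ S → algebraMap F E a * y ^ j ∈ T) :
    S ≤ T := by
  intro z hz
  have hpow (k : ℕ) : (σ ^ k) z ∈ S := by
    induction k with
    | zero => simpa using hz
    | succ k ih => rw [pow_succ', AlgEquiv.mul_apply]; exact hσ _ ih
  -- Lagrange resolvents: p j is m times the component of z in the ξ^j-eigenspace of σ.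
  let p (j : ℕ) : E := ∑ k ∈ Finset.range m, algebraMap K E ((ξ⁻¹ ^ j) ^ k) * (σ ^ k) z
  have hp (j : ℕ) : σ (p j) = algebraMap K E (ξ ^ j) * p j := by
    have hξ : ξ ^ j ≠ 0 := pow_ne_zero _ h.ξ_ne_zero
    have hstep (k : ℕ) : σ (algebraMap K E ((ξ⁻¹ ^ j) ^ k) * (σ ^ k) z) = algebraMap K E (ξ ^ j) *
        (algebraMap K E ((ξ⁻¹ ^ j) ^ (k + 1)) * (σ ^ (k + 1)) z) := by
      rw [map_mul, σ.apply_algebraMap_of_isScalarTower, pow_succ', pow_succ', map_mul, ← mul_assoc, ← mul_assoc, ← map_mul,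
        inv_pow, mul_inv_cancel₀ hξ, map_one, one_mul]
      rfl
    rw [map_sum, Finset.sum_congr rfl fun k _ => hstep k, ← Finset.mul_sum]
    congr 1
    -- Applying σ shifts the index by one; the terms at 0 and m agree because σ^m = 1 and ξ^m = 1.
    have h1 := Finset.sum_range_succ' (fun k => algebraMap K E ((ξ⁻¹ ^ j) ^ k) * (σ ^ k) z) m
    rw [Finset.sum_range_succ, h.pow_eq_one, ← pow_mul, mul_comm j m, pow_mul,
      h.inv_pow_eq_one] at h1
    simpa [p] using h1.symm
  -- Orthogonality of the powers of ξ recovers z from its resolvents.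
  have hsum : ∑ j ∈ Finset.range m, algebraMap K E (m : K)⁻¹ * p j = z := by
    rw [← Finset.mul_sum, Finset.sum_comm]
    have h1 (k : ℕ) (hk : k ∈ Finset.range m) :
        ∑ j ∈ Finset.range m, algebraMap K E ((ξ⁻¹ ^ j) ^ k) * (σ ^ k) z =
          if k = 0 then algebraMap K E m * z else 0 := by
      rw [← Finset.sum_mul, ← map_sum]
      split_ifs with h0
      · subst h0; simp
      · rw [h.sum_inv_pow (Finset.mem_range.1 hk) h0, map_zero, zero_mul]
    rw [Finset.sum_congr rfl h1, Finset.sum_ite_eq' , if_pos (Finset.mem_range.2 h.pos), ← mul_assoc,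
      ← map_mul, inv_mul_cancel₀ h.natCast_ne_zero, map_one, one_mul]
  rw [← hsum]
  refine T.sum_mem fun j _ => ?_
  have hmem : algebraMap K E (m : K)⁻¹ * p j ∈ S :=
    hS _ _ (S.sum_mem fun k _ => hS _ _ (hpow k))
  obtain ⟨a, ha⟩ := h.exists_eq_mul_pow (z := algebraMap K E (m : K)⁻¹ * p j) (j := j)
    (by rw [map_mul, σ.apply_algebraMap_of_isScalarTower, hp]; ring)
  rw [ha] at hmem ⊢
  exact hST a j hmem

theorem mul_pow_pow (a : F) (j : ℕ) :
    (algebraMap F E a * y ^ j) ^ m = algebraMap F E (a ^ m * s ^ j) := by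
  rw [mul_pow, ← pow_mul, mul_comm j m, pow_mul, h.pow_eq, map_mul, map_pow, map_pow]

variable {P : FFPlace K F}

theorem mem_nonunits_of_pow (hP : P.IsDiscrete) {P' : FFPlace K E} (hPP' : P'.LiesOver P) {z : E}
    {f : F} (hz : z ^ m = algebraMap F E f) (hf : f ≠ 0) : z ∈ P'.ring.nonunits ↔ 0 < P.ord f := by
  rw [← hP.mem_nonunits_iff hf, ← hPP'.mem_nonunits_iff, ← hz, ValuationSubring.mem_nonunits_iff,
    ValuationSubring.mem_nonunits_iff, map_pow, pow_lt_one_iff h.pos.ne']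

/-- An integral z lies in any place ring above P, so z^m = f lies in 𝒪_P; conversely, integrality of
z^m passes to z. -/
theorem isIntegralAt_of_pow [IsScalarTower K F E] (hP : P.IsDiscrete) {z : E} {f : F} (hz : z ^ m = algebraMap F E f)
    (hf : f ≠ 0) : P.IsIntegralAt z ↔ 0 ≤ P.ord f := by
  rw [← hP.mem_ring_iff hf]
  constructor
  · intro hi
    obtain ⟨P', hPP'⟩ := P.exists_liesOver (E := E)
    rw [← hPP'.mem_ring_iff, ← hz]
    exact pow_mem (hi.mem_ring hPP') m
  · intro hi
    exact FFPlace.IsIntegralAt.of_pow h.pos (hz ▸ FFPlace.IsIntegralAt.of_mem hi)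

/-- An element whose `m`-th power has the least possible positive order in `F` among the `m`-th
powers of the elements `a y ^ j`. -/
theorem exists_localParam (hP : P.IsDiscrete) : ∃ (w : E) (w₀ : F) (c : K), w₀ ≠ 0 ∧
    w ^ m = algebraMap F E w₀ ∧ P.ord w₀ = Int.gcd m (P.ord s) ∧ σ w = algebraMap K E c * w := by
  obtain ⟨t, ht0, ht⟩ := hP.exists_ord_eq_one
  -- With am + b v_P(s) = g, the element t^a y^b has m-th power t^(am) s^b, of order g at P.
  have hb := Int.gcd_eq_gcd_ab m (P.ord s)
  set a := Int.gcdA m (P.ord s)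
  set b := Int.gcdB m (P.ord s)
  refine ⟨algebraMap F E t ^ a * y ^ b, t ^ (a * m) * s ^ b, ξ ^ b,
    mul_ne_zero (zpow_ne_zero _ ht0) (zpow_ne_zero _ h.ne_zero), ?_, ?_, ?_⟩
  · rw [mul_pow, map_mul, map_zpow₀, map_zpow₀, ← h.pow_eq, ← zpow_natCast, ← zpow_mul,
      ← zpow_natCast, ← zpow_mul, ← zpow_natCast y, ← zpow_mul, mul_comm b]
  · rw [hP.ord_mul (zpow_ne_zero _ ht0) (zpow_ne_zero _ h.ne_zero), hP.ord_zpow ht0,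
      hP.ord_zpow h.ne_zero, ht, hb]
    ring
  · rw [map_mul, map_zpow₀, map_zpow₀, AlgEquiv.commutes, h.map_eq, mul_zpow, map_zpow₀]
    ring

theorem gcd_dvd_ord (hP : P.IsDiscrete) {a : F} (ha : a ≠ 0) (j : ℕ) :
    (Int.gcd m (P.ord s) : ℤ) ∣ P.ord (a ^ m * s ^ j) := by
  rw [hP.ord_mul (pow_ne_zero _ ha) (pow_ne_zero _ h.ne_zero), hP.ord_pow ha,
    hP.ord_pow h.ne_zero]
  exact dvd_add ((Int.gcd_dvd_left ..).mul_right _) ((Int.gcd_dvd_right ..).mul_left _)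

theorem gcd_pos (P : FFPlace K F) : 0 < Int.gcd m (P.ord s) :=
  Int.gcd_pos_of_ne_zero_left _ (by exact_mod_cast h.pos.ne')

end IsKummerGenerator

theorem ValuationSubring.mul_mem_nonunits {E : Type*} [Field E] {V : ValuationSubring E} {a b : E}
    (ha : a ∈ V) (hb : b ∈ V.nonunits) : a * b ∈ V.nonunits := by
  obtain ⟨hbV, hb'⟩ := ValuationSubring.mem_nonunits_iff_exists_mem_maximalIdeal.1 hb
  exact ValuationSubring.mem_nonunits_iff_exists_mem_maximalIdeal.2
    ⟨V.mul_mem _ _ ha hbV, Ideal.mul_mem_left _ ⟨a, ha⟩ hb'⟩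

namespace IsKummerGenerator

variable {K F E : Type*} [Field K] [Field F] [Field E] [Algebra K F] [Algebra K E] [Algebra F E]
  [IsScalarTower K F E] {m : ℕ} {ξ : K} {s : F} {y : E} {σ : E ≃ₐ[F] E} {P : FFPlace K F}

/-- The Galois conjugate place, obtained by pulling back the valuation ring along τ. -/
theorem exists_liesOver_mem_nonunits_iff {P' : FFPlace K E} (hPP' : P'.LiesOver P) (τ : E ≃ₐ[F] E) :
    ∃ P'' : FFPlace K E, P''.LiesOver P ∧ ∀ z, z ∈ P''.ring.nonunits ↔ τ z ∈ P'.ring.nonunits := by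
  refine ⟨⟨P'.ring.comap (τ : E →+* E), fun c => ?_, fun h => P'.ne_top ?_⟩, ?_, fun z => ?_⟩
  · rw [ValuationSubring.mem_comap]
    simpa [τ.apply_algebraMap_of_isScalarTower] using P'.const_mem c
  · rw [eq_top_iff]
    intro z _
    have : τ.symm z ∈ P'.ring.comap (τ : E →+* E) := by rw [h]; trivial
    simpa [ValuationSubring.mem_comap] using this
  · rw [FFPlace.LiesOver, ← show P'.ring.comap (algebraMap F E) = P.ring from hPP']
    ext z
    simp [ValuationSubring.mem_comap]
  · rw [ValuationSubring.mem_nonunits_iff_or, ValuationSubring.mem_nonunits_iff_or,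
      ValuationSubring.mem_comap, EmbeddingLike.map_eq_zero_iff]
    simp

variable (h : IsKummerGenerator m ξ s y σ)
include h

/-- An element lying in all places above `P` is divisible by the element `w` of
`exists_localParam` in the integral closure. -/
theorem isIntegralAt_div_of_forall_mem_nonunits (hP : P.IsDiscrete) {w : E} {w₀ : F} (hw₀ : w₀ ≠ 0)
    (hw : w ^ m = algebraMap F E w₀) (hord : P.ord w₀ = Int.gcd m (P.ord s)) {z : E}
    (hz : ∀ P' : FFPlace K E, P'.LiesOver P → z ∈ P'.ring.nonunits) : P.IsIntegralAt (z / w) := by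
  let S : AddSubgroup E :=
    { carrier := {z | ∀ P' : FFPlace K E, P'.LiesOver P → z ∈ P'.ring.nonunits}
      add_mem' := fun ha hb P' hP' => add_mem (ha P' hP') (hb P' hP')
      zero_mem' := fun P' _ => zero_mem _
      neg_mem' := fun ha P' hP' => neg_mem (ha P' hP') }
  let T : AddSubgroup E :=
    { carrier := {z | P.IsIntegralAt (z / w)}
      add_mem' := fun {a b} ha hb => by
        change P.IsIntegralAt ((a + b) / w)
        rw [add_div]; exact ha.add hb
      zero_mem' := by
        change P.IsIntegralAt (0 / w)
        rw [zero_div]; exact .zero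
      neg_mem' := fun {a} ha => by
        change P.IsIntegralAt (-a / w)
        rw [neg_div]; exact ha.neg }
  refine h.le_of_eigenvectors (S := S) (T := T) ?_ ?_ ?_ hz
  · intro c z hz P' hPP'
    exact ValuationSubring.mul_mem_nonunits (P'.const_mem c) (hz P' hPP')
  · intro z hz P' hPP'
    obtain ⟨P'', h1, h2⟩ := exists_liesOver_mem_nonunits_iff hPP' σ
    exact (h2 z).1 (hz P'' h1)
  · intro a j hS
    change P.IsIntegralAt (_ / w)
    rcases eq_or_ne a 0 with rfl | ha
    · simp only [map_zero, zero_mul, zero_div]; exact .zero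
    have hf : a ^ m * s ^ j ≠ 0 := mul_ne_zero (pow_ne_zero _ ha) (pow_ne_zero _ h.ne_zero)
    obtain ⟨P', hPP'⟩ := P.exists_liesOver (E := E)
    -- A positive order divisible by g is at least g, which is the order of w₀.
    have h1 := (h.mem_nonunits_of_pow hP hPP' (h.mul_pow_pow a j) hf).1 (hS P' hPP')
    have h2 := Int.le_of_dvd h1 (h.gcd_dvd_ord hP ha j)
    rw [h.isIntegralAt_of_pow hP (f := a ^ m * s ^ j * w₀ ^ (-1 : ℤ)) _
      (mul_ne_zero hf (zpow_ne_zero _ hw₀)), hP.ord_mul hf (zpow_ne_zero _ hw₀), hP.ord_zpow hw₀]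
    · linarith
    · rw [div_pow, h.mul_pow_pow, hw, map_mul _ (a ^ m * s ^ j), map_zpow₀, zpow_neg_one,
        div_eq_mul_inv]

/-- If w had order at least 2 at 𝔭, then (w) = 𝔭²J. Squares of elements of 𝔭J lie in (w), so these
elements lie in every place above P and are divisible by w. Thus 𝔭J = (w) = 𝔭²J, and cancellation
gives 𝔭 = 1. -/
theorem ord_localParam [FiniteDimensional F E] [Algebra.IsSeparable F E] (hP : P.IsDiscrete)
    {w : E} {w₀ : F} (hw₀ : w₀ ≠ 0)
    (hw : w ^ m = algebraMap F E w₀) (hord : P.ord w₀ = Int.gcd m (P.ord s))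
    {P' : FFPlace K E} (hPP' : P'.LiesOver P) : P'.ord w = 1 := by
  have := hP.isDedekindDomain_integralClosure (E := E)
  have := integralClosure.isFractionRing_of_finite_extension (A := P.ring) F E
  obtain ⟨p, hp⟩ := hPP'.exists_ring_eq
  have hg := h.gcd_pos P
  have hw0 : w ≠ 0 := by
    rintro rfl
    rw [zero_pow h.pos.ne', eq_comm, map_eq_zero] at hw
    exact hw₀ hw
  have hpos {P' : FFPlace K E} (hPP' : P'.LiesOver P) : w ∈ P'.ring.nonunits :=
    (h.mem_nonunits_of_pow hP hPP' hw hw₀).2 (by omega)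
  have h1 := ((hP.of_liesOver hPP').mem_nonunits_iff hw0).1 (hpos hPP')
  by_contra hne
  let w' : integralClosure P.ring E := ⟨w, (h.isIntegralAt_of_pow hP hw hw₀).2 (by omega)⟩
  have hw'0 : w' ≠ 0 := fun h0 => hw0 (congrArg Subtype.val h0)
  have hdvd : p.asIdeal ^ 2 ∣ Ideal.span {w'} := by
    rw [← p.intValuation_le_pow_iff_dvd, ← p.valuation_of_algebraMap (K := E)]
    change p.valuation E w ≤ _
    rw [FFPlace.valuation_eq_exp (p.valuation_surjective E) hp hw0, WithZero.exp_le_exp]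
    push_cast
    omega
  obtain ⟨J, hJ⟩ := hdvd
  have hle : p.asIdeal * J ≤ Ideal.span {w'} := by
    intro x hx
    have hx2 : x * x ∈ Ideal.span {w'} := by
      have := Ideal.mul_mem_mul hx hx
      rw [hJ]
      refine Ideal.mul_mono_right (Ideal.mul_le_right (I := J)) ?_
      convert this using 1
      ring
    obtain ⟨c, hc⟩ := Ideal.mem_span_singleton.1 hx2
    have hc' : (x : E) * x = w * c := congrArg Subtype.val hc
    have hint := h.isIntegralAt_div_of_forall_mem_nonunits hP hw₀ hw hord (z := x) (by
      intro P'' hPP''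
      have h3 : (x : E) ^ 2 ∈ P''.ring.nonunits := by
        rw [pow_two, hc', mul_comm]
        exact ValuationSubring.mul_mem_nonunits (FFPlace.IsIntegralAt.mem_ring c.2 hPP'')
          (hpos hPP'')
      rwa [ValuationSubring.mem_nonunits_iff, map_pow, pow_lt_one_iff two_ne_zero] at h3)
    exact Ideal.mem_span_singleton.2 ⟨⟨x / w, hint⟩, Subtype.ext (mul_div_cancel₀ _ hw0).symm⟩
  have hspan : Ideal.span {w'} ≠ ⊥ := by simpa using hw'0
  have hpJ : p.asIdeal * J ≠ 0 := by
    intro h0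
    rw [pow_two, mul_assoc, h0, mul_zero] at hJ
    exact hspan hJ
  have heq : p.asIdeal * (p.asIdeal * J) = p.asIdeal * J := by
    rw [← mul_assoc, ← pow_two, ← hJ]
    refine le_antisymm ?_ hle
    rw [hJ, pow_two, mul_assoc]
    exact Ideal.mul_le_right
  have h1 : p.asIdeal = 1 := mul_right_cancel₀ hpJ (by rw [heq, one_mul])
  exact p.isPrime.ne_top (h1.trans Ideal.one_eq_top)

/-- Computing the order of w^m = w₀ at P' in two ways gives m = e g. -/
theorem ramIdx_eq [FiniteDimensional F E] [Algebra.IsSeparable F E] (hP : P.IsDiscrete)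
    {P' : FFPlace K E} (hPP' : P'.LiesOver P) : P'.ramIdx P = m / Int.gcd m (P.ord s) := by
  obtain ⟨w, w₀, c, hw₀, hw, hord, -⟩ := h.exists_localParam hP
  have h1 := h.ord_localParam hP hw₀ hw hord hPP'
  have hw0 : w ≠ 0 := by
    rintro rfl
    rw [zero_pow h.pos.ne', eq_comm, map_eq_zero] at hw
    exact hw₀ hw
  have h2 := (hP.of_liesOver hPP').ord_pow hw0 m
  rw [hw, hPP'.ord_algebraMap_eq_ramIdx_mul hP hw₀, h1, hord, mul_one] at h2
  exact (Nat.div_eq_of_eq_mul_left (h.gcd_pos P) (by exact_mod_cast h2.symm)).symm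

/-- The complementary module is generated by w^(1-e). One inclusion is tested on eigenvectors and
uses that m is a unit in the trace of an element of F; the other uses that w is itself an
eigenvector. -/
theorem hasDifferentExponent [FiniteDimensional F E] [Algebra.IsSeparable F E] (hP : P.IsDiscrete)
    {P' : FFPlace K E} (hPP' : P'.LiesOver P) :
    P'.HasDifferentExponent P ((P'.ramIdx P : ℤ) - 1) := by
  obtain ⟨w, w₀, c, hw₀, hw, hord, hσw⟩ := h.exists_localParam hP
  have h1 := h.ord_localParam hP hw₀ hw hord hPP'
  have hw0 : w ≠ 0 := by
    rintro rfl
    rw [zero_pow h.pos.ne', eq_comm, map_eq_zero] at hw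
    exact hw₀ hw
  have hg := h.gcd_pos P
  obtain ⟨e, he⟩ : Int.gcd m (P.ord s) ∣ m := by exact_mod_cast Int.gcd_dvd_left (a := m) (b := P.ord s)
  set g := Int.gcd m (P.ord s) with hgdef
  have hram : P'.ramIdx P = e := by
    rw [h.ramIdx_eq hP hPP', ← hgdef]
    conv_lhs => rw [he]
    exact Nat.mul_div_cancel_left e hg
  have hepos : 0 < e := Nat.pos_of_ne_zero fun h0 => h.pos.ne' (by rw [he, h0, mul_zero])
  have hmge : (m : ℤ) = g * e := by exact_mod_cast he
  have hwe : w ^ (e - 1) ≠ 0 := pow_ne_zero _ hw0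
  refine ⟨(w ^ (e - 1))⁻¹, inv_ne_zero hwe, ?_, ?_⟩
  swap
  · rw [← zpow_natCast, ← zpow_neg, (hP.of_liesOver hPP').ord_zpow hw0, h1, hram]
    push_cast [Nat.cast_sub (show 1 ≤ e from hepos)]
    ring
  ext z
  constructor
  · intro hz
    refine ⟨w ^ (e - 1) * z, ?_, (inv_mul_cancel_left₀ hwe z).symm⟩
    let S : AddSubgroup E :=
      { carrier := P.complementaryModule E
        add_mem' := fun {a b} ha hb x hx => by
          rw [add_mul, map_add]; exact add_mem (ha x hx) (hb x hx)
        zero_mem' := fun x _ => by rw [zero_mul, map_zero]; exact zero_mem _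
        neg_mem' := fun {a} ha x hx => by rw [neg_mul, map_neg]; exact neg_mem (ha x hx) }
    let T : AddSubgroup E :=
      { carrier := {z | P.IsIntegralAt (w ^ (e - 1) * z)}
        add_mem' := fun {a b} ha hb => by
          change P.IsIntegralAt (_ * (a + b))
          rw [mul_add]; exact ha.add hb
        zero_mem' := by
          change P.IsIntegralAt (_ * 0)
          rw [mul_zero]; exact .zero
        neg_mem' := fun {a} ha => by
          change P.IsIntegralAt (_ * -a)
          rw [mul_neg]; exact ha.neg }
    refine h.le_of_eigenvectors (S := S) (T := T) ?_ ?_ ?_ hz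
    · intro c z hz x hx
      rw [mul_comm (algebraMap K E c), mul_assoc]
      exact hz _ (.mul (.const c) hx)
    · intro z hz x hx
      have : σ z * x = σ (z * σ.symm x) := by rw [map_mul, AlgEquiv.apply_symm_apply]
      rw [this, Algebra.trace_eq_of_algEquiv]
      exact hz _ (hx.map _)
    · intro a j hS
      change P.IsIntegralAt _
      rcases eq_or_ne a 0 with rfl | ha
      · simp only [map_zero, zero_mul, mul_zero]; exact .zero
      set z := algebraMap F E a * y ^ j with hz
      have hz0 : z ≠ 0 := mul_ne_zero (by simpa using ha) (pow_ne_zero _ h.y_ne_zero)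
      have hf : a ^ m * s ^ j ≠ 0 := mul_ne_zero (pow_ne_zero _ ha) (pow_ne_zero _ h.ne_zero)
      obtain ⟨r, hr⟩ := h.gcd_dvd_ord hP ha j
      rw [← hgdef] at hr
      rw [h.isIntegralAt_of_pow hP (f := w₀ ^ (e - 1) * (a ^ m * s ^ j)) _
        (mul_ne_zero (pow_ne_zero _ hw₀) hf), hP.ord_mul (pow_ne_zero _ hw₀) hf, hP.ord_pow hw₀,
        hord, hr]
      · by_contra hneg
        push_cast [Nat.cast_sub (show 1 ≤ e from hepos)] at hneg
        -- The order of z^m is gr. Failure of integrality means r < -(e - 1), hence r ≤ -e, and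
        -- z⁻¹t⁻¹ is then integral. Its product with z has trace m t⁻¹, which is not in 𝒪_P.
        have hre : r + e ≤ 0 := by
          by_contra hcon
          exact hneg (by nlinarith)
        obtain ⟨t, ht0, ht⟩ := hP.exists_ord_eq_one
        have hint : P.IsIntegralAt (z⁻¹ * algebraMap F E t⁻¹) := by
          rw [h.isIntegralAt_of_pow hP (f := (a ^ m * s ^ j) ^ (-1 : ℤ) * t ^ (-m : ℤ)) _
            (mul_ne_zero (zpow_ne_zero _ hf) (zpow_ne_zero _ ht0)),
            hP.ord_mul (zpow_ne_zero _ hf) (zpow_ne_zero _ ht0), hP.ord_zpow hf, hP.ord_zpow ht0,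
            hr, ht, hmge]
          · nlinarith
          · rw [mul_pow, inv_pow, h.mul_pow_pow, map_mul _ (_ ^ (-1 : ℤ)), map_zpow₀, zpow_neg_one,
              ← map_pow, inv_pow, zpow_neg, zpow_natCast]
        have htr := hS _ hint
        rw [mul_inv_cancel_left₀ hz0] at htr
        have htr2 : Algebra.trace F E (algebraMap F E t⁻¹) = algebraMap K F m * t⁻¹ := by
          apply (algebraMap F E).injective
          rw [h.trace_eq, map_mul]
          simp [AlgEquiv.commutes]
        rw [htr2] at htr
        have h5 := mul_mem (P.const_mem (m : K)⁻¹) htr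
        rw [← mul_assoc, ← map_mul, inv_mul_cancel₀ h.natCast_ne_zero, map_one, one_mul,
          ← zpow_neg_one, hP.mem_ring_iff (zpow_ne_zero _ ht0), hP.ord_zpow ht0, ht] at h5
        omega
      · rw [mul_pow, h.mul_pow_pow, ← pow_mul, mul_comm (e - 1), pow_mul, hw,
          map_mul _ (w₀ ^ (e - 1)), map_pow]
  · rintro ⟨v, hv, rfl⟩ x hx
    rw [mul_assoc]
    set u := v * x
    have hu : P.IsIntegralAt u := hv.mul hx
    set f := Algebra.trace F E ((w ^ (e - 1))⁻¹ * u) with hf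
    rcases eq_or_ne f 0 with hf0 | hf0
    · rw [hf0]; exact zero_mem _
    have hc0 : algebraMap K E c ≠ 0 := by
      intro h0
      rw [h0, zero_mul, EmbeddingLike.map_eq_zero_iff] at hσw
      exact hw0 hσw
    have hσk (k : ℕ) : (σ ^ k) w = algebraMap K E (c ^ k) * w := by
      induction k with
      | zero => simp
      | succ k ih =>
        rw [pow_succ', AlgEquiv.mul_apply, ih, map_mul, σ.apply_algebraMap_of_isScalarTower, hσw,
          pow_succ, map_mul, mul_assoc]
    -- Each conjugate of w is a constant multiple of w, so w^(e-1) clears the denominator of every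
    -- summand of the trace.
    have hint : P.IsIntegralAt (algebraMap F E f * w ^ (e - 1)) := by
      rw [hf, h.trace_eq, Finset.sum_mul]
      refine .sum fun k _ => ?_
      have : (σ ^ k) ((w ^ (e - 1))⁻¹ * u) * w ^ (e - 1) =
          algebraMap K E ((c ^ k) ^ (e - 1))⁻¹ * (σ ^ k) u := by
        rw [map_mul, map_inv₀, map_pow, hσk, mul_pow, mul_inv, ← map_pow, ← map_inv₀]
        field_simp
      rw [this]
      exact .mul (.const _) (hu.map _)
    rw [h.isIntegralAt_of_pow hP (f := f ^ m * w₀ ^ (e - 1)) _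
      (mul_ne_zero (pow_ne_zero _ hf0) (pow_ne_zero _ hw₀)),
      hP.ord_mul (pow_ne_zero _ hf0) (pow_ne_zero _ hw₀), hP.ord_pow hf0, hP.ord_pow hw₀, hord,
      hmge] at hint
    · rw [hP.mem_ring_iff hf0]
      push_cast [Nat.cast_sub (show 1 ≤ e from hepos)] at hint
      by_contra hneg
      -- This would give m v_P(f) + g(e - 1) ≤ -g < 0, against integrality.
      have h6 : P.ord f ≤ -1 := by omega
      have hg' : (0 : ℤ) < g := by exact_mod_cast hg
      have he' : (0 : ℤ) < e := by exact_mod_cast hepos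
      have h7 : (g : ℤ) * e * P.ord f ≤ g * e * (-1) := mul_le_mul_of_nonneg_left h6 (by positivity)
      nlinarith
    · rw [mul_pow, map_mul, map_pow, map_pow, ← hw, ← pow_mul, ← pow_mul, mul_comm m]

end IsKummerGenerator

/-! ### Complete splitting at rational places -/

namespace FFPlace

theorem IsRational.exists_sub_mem_nonunits {K L : Type*} [Field K] [Field L] [Algebra K L]
    {P : FFPlace K L} (hP : P.IsRational) {a : L} (ha : a ∈ P.ring) :
    ∃ κ : K, a - algebraMap K L κ ∈ P.ring.nonunits := by
  obtain ⟨κ, hκ⟩ := hP (IsLocalRing.residue P.ring ⟨a, ha⟩)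
  refine ⟨κ, ?_⟩
  have h : (⟨a, ha⟩ : P.ring) - P.constHom κ ∈ IsLocalRing.maximalIdeal P.ring := by
    rw [← Ideal.Quotient.eq]
    exact hκ.symm
  exact ValuationSubring.coe_mem_nonunits_iff.2 h

theorem eq_zero_of_const_mem_nonunits {K L : Type*} [Field K] [Field L] [Algebra K L]
    (P : FFPlace K L) {κ : K} (h : algebraMap K L κ ∈ P.ring.nonunits) : κ = 0 := by
  rw [ValuationSubring.mem_nonunits_iff_or, ← map_inv₀, map_eq_zero] at h
  exact h.resolve_right (not_not.2 (P.const_mem _))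

theorem prod_mem_nonunits {L ι : Type*} [Field L] {V : ValuationSubring L} {s : Finset ι}
    {f : ι → L} (h : ∏ i ∈ s, f i ∈ V.nonunits) : ∃ i ∈ s, f i ∈ V.nonunits := by
  classical
  induction s using Finset.induction_on with
  | empty => exact absurd h (by simp [ValuationSubring.mem_nonunits_iff])
  | insert i s hi ih =>
    rw [Finset.prod_insert hi] at h
    by_cases hf : f i ∈ V.nonunits
    · exact ⟨i, Finset.mem_insert_self i s, hf⟩
    · have hf' := hf
      rw [ValuationSubring.mem_nonunits_iff_or] at hf'
      push Not at hf'
      have h2 := ValuationSubring.mul_mem_nonunits hf'.2 h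
      rw [inv_mul_cancel_left₀ hf'.1] at h2
      obtain ⟨j, hj, hj'⟩ := ih h2
      exact ⟨j, Finset.mem_insert_of_mem hj, hj'⟩

end FFPlace

namespace IsKummerGenerator

variable {K F E : Type*} [Field K] [Field F] [Field E] [Algebra K F] [Algebra K E] [Algebra F E]
  [IsScalarTower K F E] {m : ℕ} {ξ : K} {s : F} {y : E} {σ : E ≃ₐ[F] E} {P : FFPlace K F}
  (h : IsKummerGenerator m ξ s y σ)
include h

/-- If `s` is congruent to a nonzero `m`-th power of a constant at a rational place, the place
splits completely. -/
theorem ncard_liesOver [FiniteDimensional F E] [Algebra.IsSeparable F E] (hP : P.IsDiscrete)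
    (hrat : P.IsRational) {β : K} (hβ : β ≠ 0)
    (hs : s - algebraMap K F (β ^ m) ∈ P.ring.nonunits) :
    {P' : FFPlace K E | P'.LiesOver P}.ncard = m := by
  have hsP : s ∈ P.ring := by
    have := add_mem (ValuationSubring.nonunits_subset hs) (P.const_mem (β ^ m))
    rwa [sub_add_cancel] at this
  have hsn : s ∉ P.ring.nonunits := fun hn => by
    have := sub_mem hn hs
    rw [sub_sub_cancel] at this
    exact pow_ne_zero m hβ (P.eq_zero_of_const_mem_nonunits this)
  have hords : P.ord s = 0 := by
    rw [hP.mem_ring_iff h.ne_zero] at hsP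
    rw [hP.mem_nonunits_iff h.ne_zero] at hsn
    omega
  have hconst (c : K) : algebraMap F E (algebraMap K F c) = algebraMap K E c :=
    (IsScalarTower.algebraMap_apply K F E c).symm
  have hinj {P' : FFPlace K E} {c d : K} {z : E} (h1 : z - algebraMap K E c ∈ P'.ring.nonunits)
      (h2 : z - algebraMap K E d ∈ P'.ring.nonunits) : c = d := by
    have := sub_mem h2 h1
    rw [sub_sub_sub_cancel_left, ← map_sub] at this
    exact sub_eq_zero.1 (P'.eq_zero_of_const_mem_nonunits this)
  have hyint : P.IsIntegralAt y := .of_pow h.pos (h.pow_eq ▸ .of_mem hsP)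
  -- Modulo P' one has y^m ≡ β^m, and y^m - β^m is the product of the y - ζβ over the m-th roots of
  -- unity ζ.
  have hex (P' : FFPlace K E) (hPP' : P'.LiesOver P) :
      ∃ k, k < m ∧ y - algebraMap K E (β * ξ ^ k) ∈ P'.ring.nonunits := by
    have hprim : IsPrimitiveRoot (algebraMap K E ξ) m := h.prim.map_of_injective (algebraMap K E).injective
    have h1 := hPP'.mem_nonunits_iff.2 hs
    rw [map_sub, hconst, ← h.pow_eq, map_pow, hprim.pow_sub_pow_eq_prod_sub_mul y _ h.pos] at h1
    obtain ⟨ζ, hζ, h2⟩ := FFPlace.prod_mem_nonunits h1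
    have : NeZero m := ⟨h.pos.ne'⟩
    obtain ⟨k, hk, rfl⟩ := hprim.eq_pow_of_pow_eq_one ((mem_nthRootsFinset h.pos _).1 hζ)
    exact ⟨k, hk, by rwa [map_mul, map_pow, mul_comm]⟩
  choose! κ hκm hκ using hex
  have hpow {P' : FFPlace K E} (hPP' : P'.LiesOver P) {c : K}
      (hc : y - algebraMap K E c ∈ P'.ring.nonunits) (j : ℕ) :
      y ^ j - algebraMap K E (c ^ j) ∈ P'.ring.nonunits := by
    induction j with
    | zero => simp
    | succ j ih =>
      have : y ^ (j + 1) - algebraMap K E (c ^ (j + 1)) = y ^ j * (y - algebraMap K E c) +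
        algebraMap K E c * (y ^ j - algebraMap K E (c ^ j)) := by rw [pow_succ, pow_succ, map_mul]; ring
      rw [this]
      exact add_mem (ValuationSubring.mul_mem_nonunits (pow_mem (hyint.mem_ring hPP') j) hc)
        (ValuationSubring.mul_mem_nonunits (P'.const_mem c) ih)
  have hbij : Set.BijOn κ {P' : FFPlace K E | P'.LiesOver P} (Finset.range m : Set ℕ) := by
    refine ⟨fun P' hP' => by simpa using hκm P' hP', ?_, ?_⟩
    · intro P₁ h₁ P₂ h₂ hκeq
      have hc₁ := hκ P₁ h₁
      have hc₂ := hκ P₂ h₂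
      rw [← hκeq] at hc₂
      set c := β * ξ ^ κ P₁
      let S : AddSubgroup E :=
        { carrier := {z | P.IsIntegralAt z}
          add_mem' := fun ha hb => ha.add hb
          zero_mem' := .zero
          neg_mem' := fun ha => ha.neg }
      let T : AddSubgroup E :=
        { carrier := {z | ∃ c : K, z - algebraMap K E c ∈ P₁.ring.nonunits ∧
            z - algebraMap K E c ∈ P₂.ring.nonunits}
          add_mem' := by
            rintro a b ⟨c, hc1, hc2⟩ ⟨d, hd1, hd2⟩
            refine ⟨c + d, ?_, ?_⟩ <;> rw [map_add, add_sub_add_comm]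
            exacts [add_mem hc1 hd1, add_mem hc2 hd2]
          zero_mem' := ⟨0, by simp⟩
          neg_mem' := by
            rintro a ⟨c, hc1, hc2⟩
            refine ⟨-c, ?_, ?_⟩ <;> rw [map_neg, ← neg_sub']
            exacts [neg_mem hc1, neg_mem hc2] }
      -- Two places with the same residue of y give every integral element the same residue in K. On
      -- eigenvectors a y^j this holds because v_P(s) = 0 makes a itself integral, with constant
      -- residue at the rational place P.
      have hle : S ≤ T := by
        refine h.le_of_eigenvectors (fun c z hz => .mul (.const c) hz) (fun z hz => hz.map σ) ?_
        intro a j hS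
        rcases eq_or_ne a 0 with rfl | ha
        · rw [map_zero, zero_mul]; exact T.zero_mem
        have haP : a ∈ P.ring := by
          have h1 := (h.isIntegralAt_of_pow hP (h.mul_pow_pow a j)
            (mul_ne_zero (pow_ne_zero _ ha) (pow_ne_zero _ h.ne_zero))).1 hS
          rw [hP.ord_mul (pow_ne_zero _ ha) (pow_ne_zero _ h.ne_zero), hP.ord_pow ha,
            hP.ord_pow h.ne_zero, hords, mul_zero, add_zero] at h1
          rw [hP.mem_ring_iff ha]
          exact nonneg_of_mul_nonneg_right h1 (by exact_mod_cast h.pos)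
        obtain ⟨d, hd⟩ := hrat.exists_sub_mem_nonunits haP
        have key {P' : FFPlace K E} (hPP' : P'.LiesOver P)
            (hc : y - algebraMap K E c ∈ P'.ring.nonunits) :
            algebraMap F E a * y ^ j - algebraMap K E (d * c ^ j) ∈ P'.ring.nonunits := by
          have : algebraMap F E a * y ^ j - algebraMap K E (d * c ^ j) =
              y ^ j * algebraMap F E (a - algebraMap K F d) +
              algebraMap K E d * (y ^ j - algebraMap K E (c ^ j)) := by
            rw [map_sub, hconst, map_mul]; ring
          rw [this]
          exact add_mem (ValuationSubring.mul_mem_nonunits (pow_mem (hyint.mem_ring hPP') j)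
            (hPP'.mem_nonunits_iff.2 hd)) (ValuationSubring.mul_mem_nonunits (P'.const_mem d)
            (hpow hPP' hc j))
        exact ⟨d * c ^ j, key h₁ hc₁, key h₂ hc₂⟩
      refine FFPlace.LiesOver.eq_of_nonunits hP h₁ h₂ fun z hz hz1 => ?_
      obtain ⟨d, hd1, hd2⟩ := hle hz
      obtain rfl : 0 = d := hinj (z := z) (by simpa using hz1) hd1
      simpa using hd2
    · intro k hk
      have hk' : k < m := by simpa using hk
      obtain ⟨P', hPP'⟩ := P.exists_liesOver (E := E)
      have hσk (l : ℕ) : (σ ^ l) y = algebraMap K E (ξ ^ l) * y := by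
        induction l with
        | zero => simp
        | succ l ih =>
          rw [pow_succ', AlgEquiv.mul_apply, ih, map_mul, σ.apply_algebraMap_of_isScalarTower,
            h.map_eq, pow_succ, map_mul, mul_assoc]
      have hl := hκm P' hPP'
      -- Pulling P' back along σ^l shifts its label by l mod m. This l is congruent to k - κ P' and
      -- stays a natural number.
      obtain ⟨l, hl'⟩ : ∃ l, l = k + (m - κ P') := ⟨_, rfl⟩
      obtain ⟨P'', hP'', hmem⟩ := exists_liesOver_mem_nonunits_iff hPP' (σ ^ l)
      refine ⟨P'', hP'', ?_⟩
      have h1 := (hmem _).1 (hκ P'' hP'')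
      rw [map_sub, (σ ^ _).apply_algebraMap_of_isScalarTower, hσk] at h1
      have h2 := ValuationSubring.mul_mem_nonunits (P'.const_mem (ξ ^ l)) (hκ P' hPP')
      rw [mul_sub, ← map_mul] at h2
      have h3 := hinj h2 h1
      rw [mul_left_comm, mul_right_inj' hβ, ← pow_add,
        show l + κ P' = k + m by omega, pow_add, h.prim.pow_eq_one, mul_one] at h3
      exact (h.prim.pow_inj hk' (hκm P'' hP'') h3).symm
  rw [hbij.ncard_eq]
  simp

end IsKummerGenerator

/-! ### Global Kummer theory and irreducibility -/

section Kummer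

variable {F E : Type*} [Field F] [Field E] [Algebra F E] {m : ℕ} {s : F} {y : E}

theorem finrank_eq_of_irreducible_X_pow_sub_C (hm : 0 < m) (H : Irreducible (X ^ m - C s))
    (hE : F⟮y⟯ = ⊤) (hy : y ^ m = algebraMap F E s) :
    FiniteDimensional F E ∧ Module.finrank F E = m := by
  have hmin : minpoly F y = X ^ m - C s :=
    (minpoly.eq_of_irreducible_of_monic H (by simp [hy]) (monic_X_pow_sub_C s hm.ne')).symm
  have hint : IsIntegral F y := ⟨X ^ m - C s, monic_X_pow_sub_C s hm.ne', by simp [hy]⟩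
  have h1 := adjoin.finrank hint
  have h2 := adjoin.finiteDimensional hint
  rw [hE, finrank_top', hmin, natDegree_X_pow_sub_C] at h1
  rw [hE] at h2
  exact ⟨IntermediateField.topEquiv.toLinearEquiv.finiteDimensional, h1⟩

theorem isSplittingField_of_irreducible_X_pow_sub_C (hm : 0 < m) (H : Irreducible (X ^ m - C s))
    (hζ : (primitiveRoots m F).Nonempty) (hE : F⟮y⟯ = ⊤) (hy : y ^ m = algebraMap F E s) :
    IsSplittingField F E (X ^ m - C s) := by
  obtain ⟨_, hfr⟩ := finrank_eq_of_irreducible_X_pow_sub_C hm H hE hy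
  have := isSplittingField_X_pow_sub_C_of_root_adjoin_eq_top (K := F) (L := E) (a := s) (α := y)
    (by rwa [hfr]) (by rwa [hfr]) hE
  rwa [hfr] at this

/-- The automorphisms of a Kummer extension. -/
theorem exists_kummer_automorphisms {K : Type*} [Field K] [Algebra K F] [Algebra K E]
    [IsScalarTower K F E] (hm : 0 < m) (H : Irreducible (X ^ m - C s)) (hE : F⟮y⟯ = ⊤)
    (hy : y ^ m = algebraMap F E s) {ξ : K} (hξ : IsPrimitiveRoot ξ m) :
    ∃ f : Multiplicative (ZMod m) ≃* (E ≃ₐ[F] E),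
      ∀ k : ℕ, f (Multiplicative.ofAdd (k : ZMod m)) y = y * algebraMap K E ξ ^ k := by
  have hξF : IsPrimitiveRoot (algebraMap K F ξ) m := hξ.map_of_injective (algebraMap K F).injective
  have hζ : (primitiveRoots m F).Nonempty := ⟨_, (mem_primitiveRoots hm).2 hξF⟩
  have := isSplittingField_of_irreducible_X_pow_sub_C hm H hζ hE hy
  have : NeZero m := ⟨hm.ne'⟩
  refine ⟨(autEquivZmod H E hξF).symm, fun k => ?_⟩
  rw [autEquivZmod_symm_apply_natCast H E hy hξF, Algebra.smul_def, map_pow,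
    ← IsScalarTower.algebraMap_apply, mul_comm]

theorem natCast_eq_of_mul_pow_eq {K : Type*} [Field K] [Algebra K E] (hm : 0 < m) (hy0 : y ≠ 0) {ξ : K}
    (hξ : IsPrimitiveRoot ξ m) {k l : ℕ}
    (h : y * algebraMap K E ξ ^ k = y * algebraMap K E ξ ^ l) : (k : ZMod m) = l := by
  have hξE : IsPrimitiveRoot (algebraMap K E ξ) m := hξ.map_of_injective (algebraMap K E).injective
  rw [mul_right_inj' hy0, ← pow_mod_orderOf, ← pow_mod_orderOf _ l, ← hξE.eq_orderOf] at h
  rw [ZMod.natCast_eq_natCast_iff']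
  exact hξE.pow_inj (Nat.mod_lt _ hm) (Nat.mod_lt _ hm) h

theorem exists_isKummerGenerator {K : Type*} [Field K] [Algebra K F] [Algebra K E]
    [IsScalarTower K F E] (hm : 0 < m) (hmK : (m : K) ≠ 0) (hs : s ≠ 0)
    (H : Irreducible (X ^ m - C s)) (hE : F⟮y⟯ = ⊤)
    (hy : y ^ m = algebraMap F E s) {ξ : K} (hξ : IsPrimitiveRoot ξ m) :
    ∃ σ : E ≃ₐ[F] E, IsKummerGenerator m ξ s y σ := by
  have hξF : IsPrimitiveRoot (algebraMap K F ξ) m := hξ.map_of_injective (algebraMap K F).injective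
  have hζ : (primitiveRoots m F).Nonempty := ⟨_, (mem_primitiveRoots hm).2 hξF⟩
  have := isSplittingField_of_irreducible_X_pow_sub_C hm H hζ hE hy
  have hgal := isGalois_of_isSplittingField_X_pow_sub_C hζ H E
  obtain ⟨_, hfr⟩ := finrank_eq_of_irreducible_X_pow_sub_C hm H hE hy
  have : NeZero m := ⟨hm.ne'⟩
  obtain ⟨f, hf⟩ := exists_kummer_automorphisms hm H hE hy hξ
  set σ := f (Multiplicative.ofAdd (1 : ZMod m)) with hσ
  have hpow (k : ℕ) : σ ^ k = f (Multiplicative.ofAdd (k : ZMod m)) := by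
    rw [hσ, ← map_pow, ← ofAdd_nsmul, nsmul_one]
  have hgen (τ : E ≃ₐ[F] E) : ∃ k : ℕ, σ ^ k = τ := by
    refine ⟨(Multiplicative.toAdd (f.symm τ)).val, ?_⟩
    rw [hpow, ZMod.natCast_zmod_val, ofAdd_toAdd, MulEquiv.apply_symm_apply]
  have hzp (τ : E ≃ₐ[F] E) : τ ∈ Subgroup.zpowers σ := by
    obtain ⟨k, rfl⟩ := hgen τ
    exact ⟨k, zpow_natCast σ k⟩
  have hone : σ ^ m = 1 := by rw [hpow, ZMod.natCast_self, ofAdd_zero, map_one]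
  have hcard : Nat.card (E ≃ₐ[F] E) = m := by rw [IsGalois.card_aut_eq_finrank, hfr]
  have hord : orderOf σ = m := by rw [orderOf_eq_card_of_forall_mem_zpowers hzp, hcard]
  refine ⟨σ, hm, hmK, hξ, hs, hy, ?_, fun z hz => ?_, hone, fun z => ?_⟩
  · have h1 := hf 1
    rw [Nat.cast_one, pow_one] at h1
    rw [hσ, h1, mul_comm]
  · have h1 : ∀ k : ℕ, (σ ^ k) z = z := fun k => by
      induction k with
      | zero => simp
      | succ k ih => rw [pow_succ, AlgEquiv.mul_apply, hz, ih]
    have h2 : z ∈ (⊥ : IntermediateField F E) := (IsGalois.mem_bot_iff_fixed z).2 fun τ => by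
      obtain ⟨k, rfl⟩ := hgen τ
      exact h1 k
    exact IntermediateField.mem_bot.1 h2
  · classical
    rw [trace_eq_sum_automorphisms, ← IsCyclic.image_range_orderOf hzp, hord,
      Finset.sum_image]
    intro a ha b hb hab
    rw [← hord] at ha hb
    exact pow_injOn_Iio_orderOf (by simpa using ha) (by simpa using hb) hab

end Kummer

/-- Eisenstein at (X - α): a simple zero means that (X - α)² does not divide f. Gauss's lemma then
passes to the rational function field. -/
theorem irreducible_X_pow_sub_C_of_simple_root {K : Type*} [Field K] {f : K[X]} {α : K}
    (h0 : f.eval α = 0) (h1 : (derivative f).eval α ≠ 0) {m : ℕ} (hm : 0 < m) :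
    Irreducible (X ^ m - C (algebraMap K[X] (RatFunc K) f)) := by
  have hmon : (X ^ m - C f : K[X][X]).Monic := monic_X_pow_sub_C f hm.ne'
  have hprime : (Ideal.span {(X - C α : K[X])}).IsPrime :=
    (Ideal.span_singleton_prime (X_sub_C_ne_zero α)).2 (prime_X_sub_C α)
  have hmem : f ∈ Ideal.span {(X - C α : K[X])} :=
    Ideal.mem_span_singleton.2 (dvd_iff_isRoot.2 h0)
  have hE : (X ^ m - C f : K[X][X]).IsEisensteinAt (Ideal.span {(X - C α : K[X])}) := by
    refine ⟨?_, fun {k} hk => ?_, ?_⟩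
    · rw [hmon.leadingCoeff]
      exact fun h => hprime.ne_top ((Ideal.eq_top_iff_one _).2 h)
    · rw [natDegree_X_pow_sub_C] at hk
      rw [coeff_sub, coeff_X_pow, if_neg hk.ne, coeff_C, zero_sub]
      split_ifs
      · exact neg_mem hmem
      · simp
    · rw [coeff_sub, coeff_X_pow, if_neg hm.ne, coeff_C_zero, zero_sub, neg_mem_iff,
        Ideal.span_singleton_pow, Ideal.mem_span_singleton]
      rintro ⟨g, rfl⟩
      apply h1
      simp [derivative_mul, derivative_pow]
  have h := hE.irreducible hprime hmon.isPrimitive (by rwa [natDegree_X_pow_sub_C])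
  rw [hmon.irreducible_iff_irreducible_map_fraction_map (K := RatFunc K)] at h
  simpa using h

theorem exists_isPrimitiveRoot_card_sub_one (K : Type*) [Field K] [Finite K] :
    ∃ ζ : K, IsPrimitiveRoot ζ (Nat.card K - 1) := by
  obtain ⟨g, hg⟩ := IsCyclic.exists_ofOrder_eq_natCard (α := Kˣ)
  refine ⟨g, IsPrimitiveRoot.coe_units_iff.2 ?_⟩
  rw [← Nat.card_units, ← hg]
  exact IsPrimitiveRoot.orderOf g

theorem exists_isPrimitiveRoot_of_card {K : Type*} [Field K] [Finite K] {a m : ℕ} (ham : 0 < a * m)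
    (hK : Nat.card K - 1 = a * m) : ∃ ξ : K, IsPrimitiveRoot ξ m := by
  obtain ⟨ζ, hζ⟩ := exists_isPrimitiveRoot_card_sub_one K
  rw [hK] at hζ
  exact ⟨ζ ^ a, hζ.pow ham rfl⟩

/-- In the cyclic group K^× of order am, the elements killed by a are the m-th powers. With a = q -
1 this applies to 𝔽_q^×. -/
theorem exists_pow_eq_of_pow_eq_one {K : Type*} [Field K] [Finite K] {a m : ℕ} (ham : 0 < a * m)
    (hK : Nat.card K - 1 = a * m) {c : K} (hc : c ^ a = 1) : ∃ β : K, β ^ m = c := by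
  obtain ⟨ζ, hζ⟩ := exists_isPrimitiveRoot_card_sub_one K
  rw [hK] at hζ
  have : NeZero (a * m) := ⟨ham.ne'⟩
  obtain ⟨j, -, rfl⟩ := hζ.eq_pow_of_pow_eq_one (show c ^ (a * m) = 1 by rw [pow_mul, hc, one_pow])
  rw [← pow_mul, hζ.pow_eq_one_iff_dvd, mul_comm j] at hc
  obtain ⟨l, rfl⟩ := Nat.dvd_of_mul_dvd_mul_left (Nat.pos_of_mul_pos_right ham) hc
  exact ⟨ζ ^ l, by rw [← pow_mul, mul_comm]⟩

namespace FFPlace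

variable {K : Type*} [Field K]

theorem algebraMap_polynomial_mem_ring {P : FFPlace K (RatFunc K)} (hP : P ≠ infty K) (f : K[X]) :
    algebraMap K[X] (RatFunc K) f ∈ P.ring := by
  rcases eq_or_ne f 0 with rfl | hf
  · rw [map_zero]; exact zero_mem _
  · exact (P.isDiscrete.mem_ring_iff (by simpa using hf)).2 (ord_polynomial_nonneg hP hf)

/-- Take α to be the residue of x; then X - α divides f - f(α). -/
theorem IsRational.exists_eval {P : FFPlace K (RatFunc K)} (hrat : P.IsRational)
    (hP : P ≠ infty K) : ∃ α : K, ∀ f : K[X], algebraMap K[X] (RatFunc K) f -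
      algebraMap K (RatFunc K) (f.eval α) ∈ P.ring.nonunits := by
  obtain ⟨α, hα⟩ := hrat.exists_sub_mem_nonunits (algebraMap_polynomial_mem_ring hP X)
  refine ⟨α, fun f => ?_⟩
  obtain ⟨g, hg⟩ := X_sub_C_dvd_sub_C_eval (a := α) (p := f)
  have hC (c : K) : algebraMap K (RatFunc K) c = algebraMap K[X] (RatFunc K) (C c) :=
    IsScalarTower.algebraMap_apply K K[X] (RatFunc K) c
  rw [hC, ← map_sub] at hα ⊢
  rw [hg, mul_comm, map_mul]
  exact ValuationSubring.mul_mem_nonunits (algebraMap_polynomial_mem_ring hP g) hα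

end FFPlace

/-- For k ≠ 0 the gcd is at most |k| < m, so it is a proper divisor of m. -/
theorem one_lt_div_gcd_iff {m : ℕ} (hm : 0 < m) {k : ℤ} (hk : |k| < m) :
    1 < m / Int.gcd m k ↔ k ≠ 0 := by
  constructor
  · rintro h rfl
    rw [Int.gcd_zero_right, Int.natAbs_natCast, Nat.div_self hm] at h
    exact lt_irrefl _ h
  · intro h0
    have hpos : 0 < Int.gcd m k := Int.gcd_pos_of_ne_zero_right _ h0
    have hdvd : Int.gcd m k ∣ m := by exact_mod_cast Int.gcd_dvd_left (a := m) (b := k)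
    have hle : (Int.gcd m k : ℤ) ≤ |k| :=
      Int.le_of_dvd (abs_pos.2 h0) ((dvd_abs _ _).2 (Int.gcd_dvd_right ..))
    obtain ⟨e, he⟩ := hdvd
    have : m / Int.gcd m k = e := Nat.div_eq_of_eq_mul_right hpos he
    rw [this]
    by_contra hcon
    have h1 : e ≤ 1 := by omega
    have h2 : Int.gcd m k * e ≤ Int.gcd m k * 1 := Nat.mul_le_mul_left _ h1
    omega

theorem geom_sum_eq_add (q : ℕ) {n i : ℕ} (h : i ≤ n) : ∑ j ∈ Finset.range n, q ^ j =
    ∑ j ∈ Finset.range (n - i), q ^ j + q ^ (n - i) * ∑ j ∈ Finset.range i, q ^ j := by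
  conv_lhs => rw [← Nat.sub_add_cancel h, Finset.sum_range_add]
  rw [Finset.mul_sum]
  simp only [pow_add]

/-! ### The main theorem -/

theorem theorem4p25 {K : Type*} [Field K] [Finite K] (q n i : ℕ) (hq : IsPrimePow q)
    (hn : 2 ≤ n) (hK : Nat.card K = q ^ n) (hi : 1 ≤ i) (hin : i ≤ n - 1)
    {E : Type*} [Field E] [Algebra K E] [Algebra (RatFunc K) E] [IsScalarTower K (RatFunc K) E]
    (s : RatFunc K) (hs : s = algebraMap K[X] (RatFunc K) (nqSymm K q n i))
    (y : E) (hE : (RatFunc K)⟮y⟯ = ⊤)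
    (hy : y ^ ((q ^ n - 1) / (q - 1)) = algebraMap (RatFunc K) E s) :
    -- (i) the extension is cyclic Galois of the stated degree, with the stated Galois group
    (IsGalois (RatFunc K) E ∧ IsCyclic (E ≃ₐ[RatFunc K] E) ∧
      Module.finrank (RatFunc K) E = (q ^ n - 1) / (q - 1) ∧
      (∃ ξ : K, IsPrimitiveRoot ξ ((q ^ n - 1) / (q - 1))) ∧
      ∀ ξ : K, IsPrimitiveRoot ξ ((q ^ n - 1) / (q - 1)) →
        (∀ k ∈ Set.Icc 1 ((q ^ n - 1) / (q - 1)),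
          ∃! σ : E ≃ₐ[RatFunc K] E, σ y = y * algebraMap K E ξ ^ k) ∧
        (∀ σ : E ≃ₐ[RatFunc K] E,
          ∃! k : ℕ, k ∈ Set.Icc 1 ((q ^ n - 1) / (q - 1)) ∧ σ y = y * algebraMap K E ξ ^ k)) ∧
    -- (ii) ramified places, ramification indices, tameness, different exponents, valuations
    ((∀ P : FFPlace K (RatFunc K), P.IsRamifiedIn E ↔ P = FFPlace.infty K ∨ 0 < P.ord s) ∧
      (∀ (P : FFPlace K (RatFunc K)) (P' : FFPlace K E), P'.LiesOver P → 0 < P.ord s →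
        P'.ramIdx P = Module.finrank (RatFunc K) E /
          Int.gcd (Module.finrank (RatFunc K) E : ℤ) (P.ord s)) ∧
      (∀ P' : FFPlace K E, P'.LiesOver (FFPlace.infty K) →
        P'.ramIdx (FFPlace.infty K) = Module.finrank (RatFunc K) E /
          Int.gcd (Module.finrank (RatFunc K) E : ℤ) ((FFPlace.infty K).ord s)) ∧
      (∀ (P : FFPlace K (RatFunc K)) (P' : FFPlace K E), P'.LiesOver P →
        ¬ ringChar K ∣ P'.ramIdx P ∧
        P'.HasDifferentExponent P ((P'.ramIdx P : ℤ) - 1)) ∧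
      (FFPlace.zeroOf (0 : K)).ord s = (((q ^ i - 1) / (q - 1) : ℕ) : ℤ) ∧
      (FFPlace.infty K).ord s = -((q ^ (n - i) * ((q ^ i - 1) / (q - 1)) : ℕ) : ℤ)) ∧
    -- (iii) all other rational places split completely
    (∀ P : FFPlace K (RatFunc K), P.IsRational → P ≠ FFPlace.infty K → ¬ 0 < P.ord s →
      P.SplitsCompletelyIn E) := by
  have hfin : Fintype K := Fintype.ofFinite K
  classical
  obtain ⟨p, k, hp, hk, rfl⟩ := (isPrimePow_nat_iff _).1 hq
  have hchar : CharP K p := charP_of_card hp hK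
  have : Fact p.Prime := ⟨hp⟩
  obtain ⟨φ, hφ⟩ := exists_ringHom_eq_pow (R := K) (p := p) k
  obtain ⟨ψ, hψ⟩ := exists_ringHom_eq_pow (R := K[X]) (p := p) k
  set q := p ^ k with hqdef
  have hq2 : 2 ≤ q := hq.two_le
  have hq0 : (q : K) = 0 := by
    rw [hqdef, Nat.cast_pow, CharP.cast_eq_zero, zero_pow hk.ne']
  have hin' : i < n := by omega
  rw [← Nat.geomSum_eq hq2] at hy
  simp only [← Nat.geomSum_eq hq2]
  set m := ∑ j ∈ Finset.range n, q ^ j with hm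
  set f := nqSymm K q n i with hf
  have hgpos {l : ℕ} (hl : 1 ≤ l) : 0 < ∑ j ∈ Finset.range l, q ^ j :=
    Finset.sum_pos (fun _ _ => Nat.pow_pos (by omega)) ⟨0, by simp; omega⟩
  have hmpos : 0 < m := hgpos (by omega)
  -- All terms of the geometric sum except the first vanish in K, so m = 1 there.
  have hmK : (m : K) ≠ 0 := by
    obtain ⟨n', rfl⟩ := Nat.exists_eq_succ_of_ne_zero (show n ≠ 0 by omega)
    rw [hm, Nat.succ_eq_add_one, Finset.sum_range_succ']
    push_cast
    simp [hq0]
  have hcardm : Nat.card K - 1 = (q - 1) * m := by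
    rw [hK, hm, mul_comm, Nat.geomSum_eq hq2,
      Nat.div_mul_cancel (by simpa using Nat.sub_dvd_pow_sub_pow q 1 n)]
  have hprodpos : 0 < (q - 1) * m := Nat.mul_pos (by omega) hmpos
  obtain ⟨hmonic, hdeg⟩ := frobSymm.monic_natDegree (K := K) hq2 hin'.le
  rw [← nqSymm_eq_frobSymm, ← hf] at hmonic hdeg
  have hf0 : f ≠ 0 := hmonic.ne_zero
  have hs0 : s ≠ 0 := by rw [hs]; simpa using hf0
  have hdeglt : f.natDegree < m := by
    rw [hdeg, hm, geom_sum_eq_add q hin'.le]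
    have := hgpos (l := n - i) (by omega)
    omega
  have hdegpos : 0 < f.natDegree := by
    rw [hdeg]; exact Nat.mul_pos (Nat.pow_pos (by omega)) (hgpos hi)
  obtain ⟨α, hα0, hα1⟩ := exists_simple_root_nqSymm hq2 φ hφ ψ hψ hq0
    (by rw [← Nat.card_eq_fintype_card, hK]) hi hin'
  have H : Irreducible (X ^ m - C s) := by
    rw [hs]; exact irreducible_X_pow_sub_C_of_simple_root hα0 hα1 hmpos
  obtain ⟨ξ, hξ⟩ := exists_isPrimitiveRoot_of_card hprodpos hcardm
  obtain ⟨_, hfr⟩ := finrank_eq_of_irreducible_X_pow_sub_C hmpos H hE hy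
  have hζ : (primitiveRoots m (RatFunc K)).Nonempty := ⟨algebraMap K (RatFunc K) ξ,
    (mem_primitiveRoots hmpos).2 (hξ.map_of_injective (algebraMap K (RatFunc K)).injective)⟩
  have hsplit := isSplittingField_of_irreducible_X_pow_sub_C hmpos H hζ hE hy
  have hgal : IsGalois (RatFunc K) E := isGalois_of_isSplittingField_X_pow_sub_C hζ H E
  have : NeZero m := ⟨hmpos.ne'⟩
  have hcyc : IsCyclic (E ≃ₐ[RatFunc K] E) := isCyclic_of_isSplittingField_X_pow_sub_C hζ H E
  obtain ⟨σ, hσ⟩ := exists_isKummerGenerator hmpos hmK hs0 H hE hy hξ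
  have hram (P : FFPlace K (RatFunc K)) (P' : FFPlace K E) (hPP' : P'.LiesOver P) :
      P'.ramIdx P = m / Int.gcd m (P.ord s) := hσ.ramIdx_eq P.isDiscrete hPP'
  have hordinf : (FFPlace.infty K).ord s = -(f.natDegree : ℤ) := by
    rw [hs]; exact FFPlace.ord_infty hf0
  have hordnn {P : FFPlace K (RatFunc K)} (hP : P ≠ FFPlace.infty K) : 0 ≤ P.ord s := by
    rw [hs]; exact FFPlace.ord_polynomial_nonneg hP hf0
  have hordle (P : FFPlace K (RatFunc K)) : P.ord s ≤ f.natDegree := by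
    rw [hs]; exact FFPlace.ord_polynomial_le hf0
  have hne0 (P : FFPlace K (RatFunc K)) :
      P.ord s ≠ 0 ↔ P = FFPlace.infty K ∨ 0 < P.ord s := by
    by_cases hP : P = FFPlace.infty K
    · rw [hP, hordinf]; simp; omega
    · have := hordnn hP
      simp only [hP, false_or]
      omega
  -- As no order of s is a nonzero multiple of m, every place with v_P(s) ≠ 0 really ramifies.
  have habs (P : FFPlace K (RatFunc K)) : |P.ord s| < m := by
    have h1 := hordle P
    by_cases hP : P = FFPlace.infty K
    · rw [hP, hordinf, abs_neg, Nat.abs_cast]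
      exact_mod_cast hdeglt
    · rw [abs_of_nonneg (hordnn hP)]
      omega
  refine ⟨⟨hgal, hcyc, hfr, ⟨ξ, hξ⟩, fun ξ hξ => ?_⟩, ⟨fun P => ?_, ?_, ?_, ?_, ?_, ?_⟩, ?_⟩
  · obtain ⟨g, hg⟩ := exists_kummer_automorphisms hmpos H hE hy hξ
    have hgval (σ : E ≃ₐ[RatFunc K] E) :
        σ y = y * algebraMap K E ξ ^ (Multiplicative.toAdd (g.symm σ)).val := by
      rw [← hg, ZMod.natCast_zmod_val, ofAdd_toAdd, MulEquiv.apply_symm_apply]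
    have heq {σ : E ≃ₐ[RatFunc K] E} {k : ℕ} (h : σ y = y * algebraMap K E ξ ^ k) :
        Multiplicative.toAdd (g.symm σ) = (k : ZMod m) := by
      rw [hgval] at h
      rw [← natCast_eq_of_mul_pow_eq hmpos hσ.y_ne_zero hξ h, ZMod.natCast_zmod_val]
    refine ⟨fun k _ => ⟨_, hg k, fun τ hτ => ?_⟩, fun τ => ?_⟩
    · rw [← heq hτ, ofAdd_toAdd, MulEquiv.apply_symm_apply]
    · have hlt := ZMod.val_lt (Multiplicative.toAdd (g.symm τ))
      -- Exponents run over 1, …, m, so the identity is represented by m instead of 0.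
      have hex : ∃ k : ℕ, k ∈ Set.Icc 1 m ∧ τ y = y * algebraMap K E ξ ^ k := by
        rcases Nat.eq_zero_or_pos (Multiplicative.toAdd (g.symm τ)).val with h0 | h0
        · refine ⟨m, ⟨hmpos, le_rfl⟩, ?_⟩
          rw [hgval, h0, pow_zero, ← map_pow, hξ.pow_eq_one, map_one]
        · exact ⟨_, ⟨h0, hlt.le⟩, hgval τ⟩
      obtain ⟨k, hk, hkτ⟩ := hex
      refine ⟨k, ⟨hk, hkτ⟩, fun l ⟨hl, hlτ⟩ => ?_⟩
      have h1 : (l : ZMod m) = k := (heq hlτ).symm.trans (heq hkτ)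
      have h2 : l ≡ k [MOD m] := (ZMod.natCast_eq_natCast_iff _ _ _).1 h1
      rw [Set.mem_Icc] at hk hl
      rcases le_total l k with h | h
      · obtain ⟨c, hc⟩ := (Nat.modEq_iff_dvd' h).1 h2
        rcases Nat.eq_zero_or_pos c with rfl | hc0
        · omega
        · have : m * 1 ≤ m * c := Nat.mul_le_mul_left m hc0
          omega
      · obtain ⟨c, hc⟩ := (Nat.modEq_iff_dvd' h).1 h2.symm
        rcases Nat.eq_zero_or_pos c with rfl | hc0
        · omega
        · have : m * 1 ≤ m * c := Nat.mul_le_mul_left m hc0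
          omega
  · rw [← hne0, ← one_lt_div_gcd_iff hmpos (habs P)]
    constructor
    · rintro ⟨P', hPP', h1⟩
      rwa [hram P P' hPP'] at h1
    · intro h1
      obtain ⟨P', hPP'⟩ := P.exists_liesOver (E := E)
      exact ⟨P', hPP', by rwa [hram P P' hPP']⟩
  · intro P P' hPP' _
    rw [hfr, hram P P' hPP']
  · intro P' hPP'
    rw [hfr, hram _ P' hPP']
  · intro P P' hPP'
    refine ⟨fun hdvd => hmK ?_, hσ.hasDifferentExponent P.isDiscrete hPP'⟩
    rw [← ringChar.spec] at hdvd
    -- Tameness: e divides m, which is nonzero in K.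
    have h1 : P'.ramIdx P ∣ m := by
      rw [hram P P' hPP']
      exact Nat.div_dvd_of_dvd (by exact_mod_cast Int.gcd_dvd_left (a := m) (b := P.ord s))
    obtain ⟨c, hc⟩ := h1
    rw [hc, Nat.cast_mul, hdvd, zero_mul]
  · obtain ⟨u, hu, hfu⟩ := frobSymm.exists_eq_X_pow_mul (K := K) hq2 hin'.le
    rw [hs, hf, nqSymm_eq_frobSymm, hfu, ← FFPlace.ord_zeroOf (α := (0 : K)) (u := u)
      (by rw [hu]; exact one_ne_zero), C_0, sub_zero]
  · rw [hordinf, hdeg]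
  · intro P hrat hP hPs
    rw [FFPlace.SplitsCompletelyIn, hfr]
    obtain ⟨α, hα⟩ := hrat.exists_eval hP
    have hsα := hα f
    rw [← hs] at hsα
    have hne : f.eval α ≠ 0 := by
      intro h0
      rw [h0, map_zero, sub_zero] at hsα
      exact hPs ((P.isDiscrete.mem_nonunits_iff hs0).1 hsα)
    -- The value s(α) is nonzero and fixed by the q-power map, so it lies in 𝔽_q^×.
    have hpow : f.eval α ^ (q - 1) = 1 := by
      have h1 := frobSymm.pow_eq_self q φ hφ (n := n) (x := α)
        (by rw [← hK, Nat.card_eq_fintype_card, FiniteField.pow_card]) i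
      rw [← eval_nqSymm, ← hf] at h1
      apply mul_right_cancel₀ hne
      rw [← pow_succ, Nat.sub_add_cancel (by omega), h1, one_mul]
    obtain ⟨β, hβ⟩ := exists_pow_eq_of_pow_eq_one hprodpos hcardm hpow
    refine hσ.ncard_liesOver P.isDiscrete hrat (β := β) ?_ (by rwa [hβ])
    rintro rfl
    rw [zero_pow hmpos.ne'] at hβ
    exact hne hβ.symm
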